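/- Let $\mathbb D=\{z\in\mathbb C:|z|<1\}$, and let $\Omega\subsetneq\mathbb C$ be a domain with $1\in\Omega$ that is starlike with respect to $1$ and symmetric with respect to $\mathbb R$ (i.e. $\overline{w}\in\Omega$ for all $w\in\Omega$). Let $\phi_\Omega$ be the conformal mapping of $\mathbb D$ onto $\Omega$ with $\phi_\Omega(0)=1$ and $\phi_\Omega'(0)>0$, and put $$k_\Omega(z)=\int_0^z\exp\left(\int_0^t\frac{\phi_\Omega(\zeta)-1}{\zeta}\,d\zeta\right)dt,\qquad z\in\mathbb D.$$ Let $\mathcal C(\Omega)$ be the class of analytic functions $f$ on $\mathbb D$ with $f(0)=0$, $f'(0)=1$ and $1+zf''(z)/f'(z)\in\Omega$ for all $z\in\mathbb D$ (in particular $f'$ has no zeros). For a measurable set $E\subset[-\pi,\pi]$, the length of the image under an analytic function $f$ of $\{re^{is}:s\in E\}$ is understood as $\int_E r|f'(re^{is})|\,ds$, i.e. counted with multiplicity. Then for every $r\in(0,1)$ the function $\theta\mapsto\log|k_\Omega'(re^{i\theta})|$ is even on $\mathbb R$ and strictly decreasing on $[0,\pi]$. Moreover, for every $f\in\mathcal C(\Omega)$,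 every convex nondecreasing function $\Phi:\mathbb R\to\mathbb R$ and every Lebesgue measurable set $E\subset[-\pi,\pi]$ of Lebesgue measure $2\theta$, the integrals below exist and $$\int_E\Phi\bigl(\log|f'(re^{is})|\bigr)\,ds\le\int_{-\theta}^{\theta}\Phi\bigl(\log|k_\Omega'(re^{is})|\bigr)\,ds.$$ In particular, $$\int_E r|f'(re^{is})|\,ds\le\int_{-\theta}^{\theta}r|k_\Omega'(re^{is})|\,ds,$$ i.e. the length of the image of $\{re^{is}:s\in E\}$ under $f$ does not exceed the length of the image of $\{re^{is}:|s|\le\theta\}$ under $k_\Omega$. -/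

import Mathlib

open scoped ComplexConjugate

/-- `φ` is the conformal mapping of the unit disk onto `Ω`, normalised by
`φ 0 = 1` and `φ' 0 > 0`. (Only the values of `φ` on the disk matter.) -/
structure IsNormalizedConformalMap (Ω : Set ℂ) (φ : ℂ → ℂ) : Prop where
  differentiableOn : DifferentiableOn ℂ φ (Metric.ball 0 1)
  injOn : Set.InjOn φ (Metric.ball 0 1)
  image_eq : φ '' Metric.ball 0 1 = Ω
  map_zero : φ 0 = 1
  deriv_zero_re_pos : 0 < (deriv φ 0).re
  deriv_zero_im : (deriv φ 0).im = 0

/-- The complex line integral of `g` from `0` to `z` along the straight segment. -/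
noncomputable def segmentIntegral (g : ℂ → ℂ) (z : ℂ) : ℂ :=
  ∫ t in (0 : ℝ)..1, g ((t : ℂ) * z) * z

/-- The function `k(z) = ∫₀ᶻ exp (∫₀ᵗ (φ ζ - 1) / ζ dζ) dt` built from `φ`. The integrand of the
inner integral has a removable singularity at `ζ = 0`, so its value there is irrelevant. -/
noncomputable def extremalMap (φ : ℂ → ℂ) : ℂ → ℂ :=
  segmentIntegral fun t => Complex.exp (segmentIntegral (fun ζ => (φ ζ - 1) / ζ) t)

/-- The class `𝒞(Ω)` of analytic functions `f` on the unit disk with `f 0 = 0`, `f' 0 = 1` and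
`1 + z f''(z) / f'(z) ∈ Ω` for all `z` in the disk. For the quotient to be a complex number, its
denominator must not vanish; this is recorded explicitly since division by zero is total here. -/
structure MemConvexClass (Ω : Set ℂ) (f : ℂ → ℂ) : Prop where
  differentiableOn : DifferentiableOn ℂ f (Metric.ball 0 1)
  map_zero : f 0 = 0
  deriv_zero : deriv f 0 = 1
  mem : ∀ z ∈ Metric.ball (0 : ℂ) 1,
    deriv f z ≠ 0 ∧ 1 + z * deriv (deriv f) z / deriv f z ∈ Ω

/-- The point `r e^{iθ}`. -/
noncomputable def circlePoint (r θ : ℝ) : ℂ := (r : ℂ) * Complex.exp ((θ : ℂ) * Complex.I)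

/-- The length (counted with multiplicity) of the image under `f` of the part
`{r e^{is} : s ∈ E}` of the circle of radius `r`. -/
noncomputable def imageLength (f : ℂ → ℂ) (r : ℝ) (E : Set ℝ) : ℝ :=
  ∫ s in E, r * ‖deriv f (circlePoint r s)‖

open Set Filter Topology Metric

/-! Put `q = φ - 1`, univalent on the disk, vanishing at `0`, with image starlike about `0`. Let `h`
be the primitive of `q(ζ)/ζ` with `h 0 = 0`; then `k' = exp h`, so `log |k'| = Re h`. For `f` in the
class, `f' = exp g` with `g 0 = 0`, and `z g'(z)` takes its values in `q(𝔻)`, where `q = z h'`.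

Three facts carry the proof. (1) Subordination: starlikeness of `q` makes `h` univalent
(`injOn_ball_of_starlike`), and a Jack-type maximum argument lifts `z g' ≺ z h'` to `g ≺ h`, that
is, `g = h ∘ w` with `|w z| ≤ |z|` (`exists_schwarz_subordination`). (2) Littlewood: hence `∫ Ψ(Re
g) ≤ ∫ Ψ(Re h)` over the full circle for every convex `Ψ` (`circleAverage_comp_schwarz_le`). (3)
Symmetry: the derivative of `U(s) = Re h(re^{is})` is `-Im φ(re^{is})`. Since `φ` commutes with
conjugation and maps the upper half-disk into the upper half-plane, `U` is even and strictly
decreasing on `[0, π]`.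

To pass from the full circle to `E`, apply (2) to `Ψ = max(Φ - b, 0)` with `b = Φ(U(θ))`: by (3), `Ψ
∘ U` equals `Φ ∘ U - b` on `[-θ, θ]` and vanishes elsewhere
(`setIntegral_convex_le_of_symmetric_decreasing`). Lengths are the case `Φ = r exp`. -/

theorem HasDerivAt.nonpos_of_right_le {f : ℝ → ℝ} {f' a ε : ℝ} (hf : HasDerivAt f f' a)
    (hε : 0 < ε) (h : ∀ t ∈ Ioo a (a + ε), f t ≤ f a) : f' ≤ 0 := by
  have h1 := (hasDerivAt_iff_tendsto_slope.1 hf).mono_left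
    (nhdsWithin_mono a (fun x (hx : x ∈ Ioi a) => (ne_of_gt hx : x ≠ a)))
  refine le_of_tendsto h1 ?_
  filter_upwards [Ioo_mem_nhdsGT (show a < a + ε by linarith)] with t ht
  rw [slope_def_field]
  exact div_nonpos_of_nonpos_of_nonneg (by linarith [h t ht]) (by linarith [ht.1])

/-- Continuous induction on the radius: the infimum of the radii where `P` fails satisfies `P` by
`hleft`, and `hright` then moves past it. It serves both for univalence of `h` and for the inclusion
of `g(𝔻)` in `h(𝔻)`. -/
theorem forall_mem_Ico_of_radial_induction {P : ℝ → Prop} (h0 : P 0)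
    (hmono : ∀ σ ρ, σ ≤ ρ → P ρ → P σ)
    (hleft : ∀ ρ, 0 < ρ → ρ < 1 → (∀ σ, 0 ≤ σ → σ < ρ → P σ) → P ρ)
    (hright : ∀ ρ, 0 ≤ ρ → ρ < 1 → P ρ → ∃ σ, ρ < σ ∧ P σ) :
    ∀ ρ, 0 ≤ ρ → ρ < 1 → P ρ := by
  by_contra! hcon
  obtain ⟨ρ₀, hρ0, hρ1, hP⟩ := hcon
  set S : Set ℝ := {ρ | 0 ≤ ρ ∧ ¬ P ρ}
  have hS : S.Nonempty := ⟨ρ₀, hρ0, hP⟩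
  have hb : BddBelow S := ⟨0, fun x hx => hx.1⟩
  have hs0 : 0 ≤ sInf S := le_csInf hS fun x hx => hx.1
  have hs1 : sInf S < 1 := (csInf_le hb ⟨hρ0, hP⟩).trans_lt hρ1
  have hlt : ∀ σ, 0 ≤ σ → σ < sInf S → P σ := fun σ h1 h2 => by
    by_contra h3
    exact absurd (csInf_le hb ⟨h1, h3⟩) (not_le.2 h2)
  have hs : P (sInf S) := by
    rcases hs0.eq_or_lt with h | h
    · rwa [← h]
    · exact hleft _ h hs1 hlt
  obtain ⟨σ, hσ, hPσ⟩ := hright _ hs0 hs1 hs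
  have : σ ≤ sInf S := le_csInf hS fun x hx => by
    by_contra h
    exact hx.2 (hmono _ _ (not_le.1 h).le hPσ)
  linarith

/-! ### Univalent functions and their holomorphic inverses -/

section Injective

variable {q : ℂ → ℂ} {U : Set ℂ}

theorem Set.InjOn.not_eventuallyEq_const (hU : IsOpen U) (hinj : InjOn q U) {z : ℂ} (hz : z ∈ U)
    (c : ℂ) : ¬ ∀ᶠ y in 𝓝 z, q y = c := by
  intro h
  obtain ⟨y, ⟨hy1, hy2⟩, hy3⟩ :=
    (((h.and (hU.mem_nhds hz)).filter_mono nhdsWithin_le_nhds).and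
      (self_mem_nhdsWithin : {z}ᶜ ∈ 𝓝[≠] z)).exists
  exact hy3 (hinj hy2 hz (hy1.trans h.self_of_nhds.symm))

theorem Set.InjOn.nhds_le_map_nhds (hU : IsOpen U) (hq : DifferentiableOn ℂ q U)
    (hinj : InjOn q U) {z : ℂ} (hz : z ∈ U) : 𝓝 (q z) ≤ map q (𝓝 z) :=
  (hq.analyticAt (hU.mem_nhds hz)).eventually_constant_or_nhds_le_map_nhds.resolve_left
    (hinj.not_eventuallyEq_const hU hz _)

theorem Set.InjOn.image_mem_nhds (hU : IsOpen U) (hq : DifferentiableOn ℂ q U)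
    (hinj : InjOn q U) {z : ℂ} (hz : z ∈ U) {V : Set ℂ} (hV : V ∈ 𝓝 z) : q '' V ∈ 𝓝 (q z) :=
  hinj.nhds_le_map_nhds hU hq hz (image_mem_map hV)

theorem Set.InjOn.isOpen_image (hU : IsOpen U) (hq : DifferentiableOn ℂ q U)
    (hinj : InjOn q U) : IsOpen (q '' U) := by
  rw [isOpen_iff_mem_nhds]
  rintro _ ⟨z, hz, rfl⟩
  exact hinj.image_mem_nhds hU hq hz (hU.mem_nhds hz)

theorem Set.InjOn.continuousAt_leftInverse (hU : IsOpen U) (hq : DifferentiableOn ℂ q U)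
    (hinj : InjOn q U) {G : ℂ → ℂ} (hG : ∀ z ∈ U, G (q z) = z) {z : ℂ} (hz : z ∈ U) :
    ContinuousAt G (q z) := by
  rw [ContinuousAt, hG z hz]
  intro V hV
  rw [mem_map]
  filter_upwards [hinj.image_mem_nhds hU hq hz (inter_mem hV (hU.mem_nhds hz))]
  rintro _ ⟨x, hx, rfl⟩
  simpa [hG x hx.2] using hx.1

theorem Set.InjOn.differentiableAt_leftInverse_of_deriv_ne_zero (hU : IsOpen U)
    (hq : DifferentiableOn ℂ q U) (hinj : InjOn q U) {G : ℂ → ℂ} (hG : ∀ z ∈ U, G (q z) = z)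
    {z : ℂ} (hz : z ∈ U) (hd : deriv q z ≠ 0) : HasDerivAt G (deriv q z)⁻¹ (q z) := by
  have h1 : HasDerivAt q (deriv q z) (G (q z)) := by
    rw [hG z hz]
    exact (hq.differentiableAt (hU.mem_nhds hz)).hasDerivAt
  refine h1.of_local_left_inverse (hinj.continuousAt_leftInverse hU hq hG hz) hd ?_
  filter_upwards [(hinj.isOpen_image hU hq).mem_nhds (mem_image_of_mem q hz)]
  rintro _ ⟨x, hx, rfl⟩
  rw [hG x hx]

/-- Zeros of `q'` are isolated, so `G` is differentiable on a punctured neighbourhood of `q z`;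
being continuous there, it extends analytically by the removable singularity theorem. Non-vanishing
of `q'` is not presupposed; it follows afterwards from `G ∘ q = id`. -/
theorem Set.InjOn.analyticAt_leftInverse (hU : IsOpen U)
    (hq : DifferentiableOn ℂ q U) (hinj : InjOn q U) {G : ℂ → ℂ} (hG : ∀ z ∈ U, G (q z) = z)
    {z : ℂ} (hz : z ∈ U) : AnalyticAt ℂ G (q z) := by
  have hc := hinj.continuousAt_leftInverse hU hq hG hz
  refine Complex.analyticAt_of_differentiable_on_punctured_nhds_of_continuousAt ?_ hc
  have hqa : AnalyticAt ℂ q z := hq.analyticAt (hU.mem_nhds hz)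
  have hne : ∀ᶠ y in 𝓝[≠] z, deriv q y ≠ 0 := by
    refine hqa.deriv.eventually_eq_zero_or_eventually_ne_zero.resolve_left fun h0 => ?_
    obtain ⟨ε, hε, hball⟩ := Metric.eventually_nhds_iff_ball.1 (h0.and (hU.mem_nhds hz))
    refine hinj.not_eventuallyEq_const hU hz (q z) ?_
    filter_upwards [ball_mem_nhds z hε] with y hy
    exact isOpen_ball.is_const_of_deriv_eq_zero (convex_ball z ε).isPreconnected
      (hq.mono fun x hx => (hball x hx).2) (fun x hx => (hball x hx).1) hy (mem_ball_self hε)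
  have htend : Tendsto G (𝓝[≠] (q z)) (𝓝[≠] z) := by
    refine tendsto_nhdsWithin_iff.2 ⟨?_, ?_⟩
    · have := hc.tendsto.mono_left (nhdsWithin_le_nhds (s := {q z}ᶜ))
      rwa [hG z hz] at this
    · filter_upwards [nhdsWithin_le_nhds ((hinj.isOpen_image hU hq).mem_nhds
        (mem_image_of_mem q hz)), self_mem_nhdsWithin]
      rintro _ ⟨x, hx, rfl⟩ hxz
      rw [hG x hx]
      rintro rfl
      exact hxz rfl
  filter_upwards [htend.eventually hne, nhdsWithin_le_nhds ((hinj.isOpen_image hU hq).mem_nhds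
        (mem_image_of_mem q hz))]
  rintro _ h1 ⟨x, hx, rfl⟩
  rw [hG x hx] at h1
  exact (hinj.differentiableAt_leftInverse_of_deriv_ne_zero hU hq hG hx h1).differentiableAt

theorem Set.InjOn.exists_differentiableOn_leftInverse (hU : IsOpen U)
    (hq : DifferentiableOn ℂ q U) (hinj : InjOn q U) :
    ∃ G : ℂ → ℂ, (∀ z ∈ U, G (q z) = z) ∧ DifferentiableOn ℂ G (q '' U) := by
  have hG : ∀ z ∈ U, Function.invFunOn q U (q z) = z := fun z hz => hinj.leftInvOn_invFunOn hz
  refine ⟨Function.invFunOn q U, hG, ?_⟩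
  rintro _ ⟨z, hz, rfl⟩
  exact (hinj.analyticAt_leftInverse hU hq hG hz).differentiableAt.differentiableWithinAt

theorem Set.InjOn.deriv_ne_zero (hU : IsOpen U)
    (hq : DifferentiableOn ℂ q U) (hinj : InjOn q U) {z : ℂ} (hz : z ∈ U) : deriv q z ≠ 0 := by
  obtain ⟨G, hG, hGd⟩ := hinj.exists_differentiableOn_leftInverse hU hq
  have h1 := (hGd.differentiableAt
    ((hinj.isOpen_image hU hq).mem_nhds (mem_image_of_mem q hz))).hasDerivAt.comp z
    (hq.differentiableAt (hU.mem_nhds hz)).hasDerivAt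
  have h2 : HasDerivAt (G ∘ q) 1 z := by
    refine (hasDerivAt_id z).congr_of_eventuallyEq ?_
    filter_upwards [hU.mem_nhds hz] with y hy using hG y hy
  intro h0
  simpa [h0] using h1.unique h2

end Injective

/-! ### Starlike univalent functions -/

section Starlike

variable {q : ℂ → ℂ}

/-- The Schwarz lemma applied to `q⁻¹ ∘ p`, a self-map of the disk fixing `0`. -/
theorem exists_schwarz_of_mapsTo_image (hq : DifferentiableOn ℂ q (ball 0 1))
    (hinj : InjOn q (ball 0 1)) (hq0 : q 0 = 0) {p : ℂ → ℂ} (hp : DifferentiableOn ℂ p (ball 0 1))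
    (hp0 : p 0 = 0) (hmaps : ∀ z ∈ ball (0 : ℂ) 1, p z ∈ q '' ball 0 1) {z : ℂ} (hz : ‖z‖ < 1) :
    ∃ w, ‖w‖ ≤ ‖z‖ ∧ q w = p z := by
  obtain ⟨G, hG, hGd⟩ := hinj.exists_differentiableOn_leftInverse isOpen_ball hq
  have hd : DifferentiableOn ℂ (G ∘ p) (ball 0 1) := hGd.comp hp hmaps
  have hm : ∀ z ∈ ball (0 : ℂ) 1, G (p z) ∈ ball (0 : ℂ) 1 ∧ q (G (p z)) = p z := by
    intro z hz
    obtain ⟨y, hy, hyz⟩ := hmaps z hz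
    rw [← hyz, hG y hy]
    exact ⟨hy, rfl⟩
  have h0 : (G ∘ p) 0 = 0 := by
    simpa [hp0, hq0] using hG 0 (mem_ball_self one_pos)
  exact ⟨G (p z), Complex.norm_le_norm_of_mapsTo_ball hd
    (fun y hy => ball_subset_closedBall (hm y hy).1) h0 hz, (hm z (by simpa using hz)).2⟩

theorem exists_norm_le_of_starlike (hq : DifferentiableOn ℂ q (ball 0 1))
    (hinj : InjOn q (ball 0 1)) (hq0 : q 0 = 0)
    (hstar : ∀ z ∈ ball (0 : ℂ) 1, ∀ t : ℝ, 0 ≤ t → t ≤ 1 → (t : ℂ) * q z ∈ q '' ball 0 1)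
    {z : ℂ} (hz : ‖z‖ < 1) {t : ℝ} (ht0 : 0 ≤ t) (ht1 : t ≤ 1) :
    ∃ w, ‖w‖ ≤ ‖z‖ ∧ q w = t * q z :=
  exists_schwarz_of_mapsTo_image hq hinj hq0 (hq.const_mul (t : ℂ)) (by simp [hq0])
    (fun y hy => hstar y hy t ht0 ht1) hz

theorem ne_zero_of_injOn_ball (hinj : InjOn q (ball 0 1)) (hq0 : q 0 = 0) {z : ℂ} (hz : ‖z‖ < 1)
    (hz0 : z ≠ 0) : q z ≠ 0 := fun h =>
  hz0 (hinj (by simpa using hz) (mem_ball_self one_pos) (h.trans hq0.symm))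

/-- Shrinking `q z` radially and pulling back by `q⁻¹` gives a curve starting at `z` that never
leaves the closed disk of radius `‖z‖`. So `‖·‖²` has nonpositive derivative along it at the start,
which says `Re (conj z * q z / q' z) ≥ 0`; this has the sign of `Re (z q'/q)`. -/
theorem re_mul_deriv_div_nonneg_of_starlike (hq : DifferentiableOn ℂ q (ball 0 1))
    (hinj : InjOn q (ball 0 1)) (hq0 : q 0 = 0)
    (hstar : ∀ z ∈ ball (0 : ℂ) 1, ∀ t : ℝ, 0 ≤ t → t ≤ 1 → (t : ℂ) * q z ∈ q '' ball 0 1)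
    {z : ℂ} (hz : ‖z‖ < 1) (hz0 : z ≠ 0) : 0 ≤ (z * deriv q z / q z).re := by
  obtain ⟨G, hG, hGd⟩ := hinj.exists_differentiableOn_leftInverse isOpen_ball hq
  have hzb : z ∈ ball (0 : ℂ) 1 := by simpa using hz
  have hqz := ne_zero_of_injOn_ball hinj hq0 hz hz0
  have hdq := hinj.deriv_ne_zero isOpen_ball hq hzb
  have hdG := hinj.differentiableAt_leftInverse_of_deriv_ne_zero isOpen_ball hq hG hzb hdq
  set w : ℝ → ℂ := fun s => G ((1 - s : ℝ) * q z) with hw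
  have hw0 : w 0 = z := by simp [hw, hG z hzb]
  have hwd : HasDerivAt w ((deriv q z)⁻¹ * (-q z)) 0 := by
    have h1 : HasDerivAt (fun s : ℝ => ((1 - s : ℝ) : ℂ) * q z) (-q z) 0 := by
      have h2 : HasDerivAt (fun s : ℝ => ((1 - s : ℝ) : ℂ)) (((-1 : ℝ) : ℂ)) 0 :=
        ((hasDerivAt_id (0 : ℝ)).const_sub 1).ofReal_comp
      simpa using h2.mul_const (q z)
    have h3 : HasDerivAt G (deriv q z)⁻¹ (((1 - (0 : ℝ) : ℝ) : ℂ) * q z) := by simpa using hdG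
    exact h3.comp (0 : ℝ) h1
  have hle : ∀ s ∈ Ioo (0 : ℝ) (0 + 1), ‖w s‖ ^ 2 ≤ ‖w 0‖ ^ 2 := by
    intro s hs
    obtain ⟨y, hy, hyq⟩ := exists_norm_le_of_starlike hq hinj hq0 hstar hz
      (t := 1 - s) (by linarith [hs.2]) (by linarith [hs.1])
    have : w s = y := by
      rw [hw]; simp only; rw [← hyq, hG y (by simpa using hy.trans_lt hz)]
    rw [this, hw0]
    gcongr
  have := hwd.norm_sq.nonpos_of_right_le one_pos hle
  rw [hw0, Complex.inner] at this
  have h4 : 0 ≤ (conj z * (q z / deriv q z)).re := by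
    have h5 : conj z * (q z / deriv q z) = -(conj z * ((deriv q z)⁻¹ * -q z)) := by
      field_simp
    have h6 : (conj z * ((deriv q z)⁻¹ * -q z)) = ((deriv q z)⁻¹ * -q z) * conj z := by ring
    rw [h5, Complex.neg_re, h6]
    linarith
  have h7 : z * deriv q z / q z
      = conj (conj z * (q z / deriv q z)) * ((‖deriv q z‖ ^ 2 / ‖q z‖ ^ 2 : ℝ) : ℂ) := by
    have e1 : ((‖deriv q z‖ ^ 2 : ℝ) : ℂ) = deriv q z * conj (deriv q z) := by
      rw [Complex.mul_conj, Complex.normSq_eq_norm_sq]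
    have e2 : ((‖q z‖ ^ 2 : ℝ) : ℂ) = q z * conj (q z) := by
      rw [Complex.mul_conj, Complex.normSq_eq_norm_sq]
    have h8 : conj (q z) ≠ 0 := by simpa using hqz
    have h9 : conj (deriv q z) ≠ 0 := by simpa using hdq
    rw [Complex.ofReal_div, e1, e2]
    simp only [map_mul, map_div₀, Complex.conj_conj]
    field_simp
  rw [h7, Complex.re_mul_ofReal, Complex.conj_re]
  positivity

end Starlike

theorem hasDerivAt_circlePoint (r s : ℝ) :
    HasDerivAt (circlePoint r) (circlePoint r s * Complex.I) s := by
  have h : HasDerivAt (fun s : ℝ => (s : ℂ) * Complex.I) (1 * Complex.I) s :=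
    (Complex.ofRealCLM.hasDerivAt (x := s)).mul_const Complex.I
  refine (h.cexp.const_mul (r : ℂ)).congr_deriv ?_
  rw [circlePoint, one_mul, mul_assoc]

theorem norm_circlePoint {r : ℝ} (hr : 0 ≤ r) (s : ℝ) : ‖circlePoint r s‖ = r := by
  simp [circlePoint, Complex.norm_exp_ofReal_mul_I, abs_of_nonneg hr]

theorem circlePoint_add_two_pi (r s : ℝ) : circlePoint r (s + 2 * Real.pi) = circlePoint r s := by
  simp only [circlePoint]
  push_cast
  rw [add_mul, Complex.exp_add, Complex.exp_two_pi_mul_I, mul_one]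

theorem circlePoint_mem_ball {r : ℝ} (hr : 0 ≤ r) (hr1 : r < 1) (s : ℝ) :
    circlePoint r s ∈ ball (0 : ℂ) 1 := by
  simpa [norm_circlePoint hr] using hr1

theorem continuous_circlePoint (r : ℝ) : Continuous (circlePoint r) := by
  unfold circlePoint
  fun_prop

/-! ### Univalence of the Alexander transform `h` -/

section AlexanderTransform

variable {q h L : ℂ → ℂ}

theorem exists_log_dslope (hq : DifferentiableOn ℂ q (ball 0 1))
    (hinj : InjOn q (ball 0 1)) (hq0 : q 0 = 0) :
    ∃ L : ℂ → ℂ, DifferentiableOn ℂ L (ball 0 1) ∧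
      ∀ z ∈ ball (0 : ℂ) 1, Complex.exp (L z) = dslope q 0 z := by
  have hQ : DifferentiableOn ℂ (dslope q 0) (ball 0 1) :=
    (Complex.differentiableOn_dslope (ball_mem_nhds 0 one_pos)).2 hq
  have hQ0 : ∀ z ∈ ball (0 : ℂ) 1, dslope q 0 z ≠ 0 := by
    intro z hz
    rcases eq_or_ne z 0 with rfl | hz0
    · rw [dslope_same]; exact hinj.deriv_ne_zero isOpen_ball hq hz
    · rw [dslope_of_ne _ hz0, slope_def_field, hq0]
      simpa using ⟨ne_zero_of_injOn_ball hinj hq0 (by simpa using hz) hz0, hz0⟩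
  have hdl : DifferentiableOn ℂ (fun z => deriv (dslope q 0) z / dslope q 0 z) (ball 0 1) :=
    (hQ.deriv isOpen_ball).div hQ hQ0
  obtain ⟨L, hL0, hL⟩ := hdl.isExactOn_ball.with_val_at 0 (Complex.log (dslope q 0 0))
  have hLd : DifferentiableOn ℂ L (ball 0 1) :=
    fun z hz => (hL z hz).differentiableAt.differentiableWithinAt
  refine ⟨L, hLd, fun z hz => ?_⟩
  have hconst : ∀ y ∈ ball (0 : ℂ) 1,
      HasDerivAt (fun y => dslope q 0 y * Complex.exp (-L y)) 0 y := by
    intro y hy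
    have h1 := (hQ.differentiableAt (isOpen_ball.mem_nhds hy)).hasDerivAt.mul (hL y hy).neg.cexp
    refine h1.congr_deriv ?_
    have := hQ0 y hy
    field_simp
    ring
  have h2 := isOpen_ball.is_const_of_deriv_eq_zero (convex_ball (0 : ℂ) 1).isPreconnected
    (fun y hy => (hconst y hy).differentiableAt.differentiableWithinAt)
    (fun y hy => (hconst y hy).deriv) hz (mem_ball_self one_pos)
  simp only [hL0, Complex.exp_neg, Complex.exp_log (hQ0 0 (mem_ball_self one_pos))] at h2
  rw [mul_inv_cancel₀ (hQ0 0 (mem_ball_self one_pos))] at h2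
  have := Complex.exp_ne_zero (L z)
  field_simp at h2
  exact h2.symm

theorem mul_dslope_zero (hq0 : q 0 = 0) (z : ℂ) : z * dslope q 0 z = q z := by
  simpa [hq0] using sub_smul_dslope q 0 z

theorem mul_deriv_div_eq_of_exp_eq_dslope (hq0 : q 0 = 0)
    (hL : DifferentiableOn ℂ L (ball 0 1))
    (hLq : ∀ z ∈ ball (0 : ℂ) 1, Complex.exp (L z) = dslope q 0 z)
    {z : ℂ} (hz : z ∈ ball (0 : ℂ) 1) (hz0 : z ≠ 0) :
    z * deriv q z / q z = 1 + z * deriv L z := by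
  have h1 : HasDerivAt (fun y => y * Complex.exp (L y))
      (1 * Complex.exp (L z) + z * (Complex.exp (L z) * deriv L z)) z :=
    (hasDerivAt_id z).mul (hL.differentiableAt (isOpen_ball.mem_nhds hz)).hasDerivAt.cexp
  have h2 : HasDerivAt q (1 * Complex.exp (L z) + z * (Complex.exp (L z) * deriv L z)) z := by
    refine h1.congr_of_eventuallyEq ?_
    filter_upwards [isOpen_ball.mem_nhds hz] with y hy
    rw [hLq y hy, mul_dslope_zero hq0]
  rw [h2.deriv, ← mul_dslope_zero hq0 z, ← hLq z hz]
  have := Complex.exp_ne_zero (L z)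
  field_simp

theorem hasDerivAt_comp_circlePoint {F : ℂ → ℂ} {F' : ℂ} {r s : ℝ}
    (hF : HasDerivAt F F' (circlePoint r s)) :
    HasDerivAt (fun s => F (circlePoint r s)) (F' * (circlePoint r s * Complex.I)) s :=
  hF.comp s (hasDerivAt_circlePoint r s)

theorem hasDerivAt_re_of_hasDerivAt {F : ℝ → ℂ} {F' : ℂ} {s : ℝ} (hF : HasDerivAt F F' s) :
    HasDerivAt (fun s => (F s).re) F'.re s :=
  Complex.reCLM.hasFDerivAt.comp_hasDerivAt s hF

theorem hasDerivAt_im_of_hasDerivAt {F : ℝ → ℂ} {F' : ℂ} {s : ℝ} (hF : HasDerivAt F F' s) :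
    HasDerivAt (fun s => (F s).im) F'.im s :=
  Complex.imCLM.hasFDerivAt.comp_hasDerivAt s hF

/-- The tangent of `s ↦ h(ρ e^{is})` is `i q`, with direction `A s + π/2`. If that direction turns
by at most `π` along `[a, b]`, the curve advances in the direction perpendicular to the middle
argument and cannot close up. -/
theorem ne_of_arg_increment_le_pi (hq0 : q 0 = 0)
    (hh : ∀ z ∈ ball (0 : ℂ) 1, HasDerivAt h (dslope q 0 z) z)
    (hLq : ∀ z ∈ ball (0 : ℂ) 1, Complex.exp (L z) = dslope q 0 z)
    {ρ : ℝ} (hρ0 : 0 < ρ) (hρ1 : ρ < 1) {A : ℝ → ℝ} (hAc : Continuous A) (hAm : Monotone A)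
    (hA : ∀ s, A s = s + (L (circlePoint ρ s)).im) {a b : ℝ} (hab : a < b)
    (hinc : A b - A a ≤ Real.pi) : h (circlePoint ρ a) ≠ h (circlePoint ρ b) := by
  intro heq
  -- With `β` the middle argument, `|A s - β| ≤ π/2` on `[a, b]`; `Y` is the component of the curve
  -- along `i e^{iβ}`.
  set β : ℝ := (A a + A b) / 2 with hβ
  set Y : ℝ → ℝ := fun s => (-Complex.I * Complex.exp (-β * Complex.I) * h (circlePoint ρ s)).re
    with hY
  have hYd : ∀ s, HasDerivAt Y (‖q (circlePoint ρ s)‖ * Real.cos (A s - β)) s := by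
    intro s
    have hm := circlePoint_mem_ball hρ0.le hρ1 s
    have h1 := hasDerivAt_re_of_hasDerivAt ((hasDerivAt_comp_circlePoint (hh _ hm)).const_mul
      (-Complex.I * Complex.exp (-β * Complex.I)))
    refine h1.congr_deriv ?_
    have hqs : q (circlePoint ρ s)
        = ((ρ * Real.exp (L (circlePoint ρ s)).re : ℝ) : ℂ) * Complex.exp (A s * Complex.I) := by
      rw [← mul_dslope_zero hq0, ← hLq _ hm, hA]
      conv_lhs => rw [← Complex.re_add_im (L (circlePoint ρ s))]
      rw [Complex.exp_add]
      nth_rewrite 1 [circlePoint]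
      push_cast
      rw [add_mul, Complex.exp_add]
      ring
    have hn : ‖q (circlePoint ρ s)‖ = ρ * Real.exp (L (circlePoint ρ s)).re := by
      rw [hqs, norm_mul, Complex.norm_exp_ofReal_mul_I, mul_one, Complex.norm_real,
        Real.norm_of_nonneg (by positivity)]
    have e1 : -Complex.I * Complex.exp (-β * Complex.I)
          * (dslope q 0 (circlePoint ρ s) * (circlePoint ρ s * Complex.I))
        = ((ρ * Real.exp (L (circlePoint ρ s)).re : ℝ) : ℂ)
          * Complex.exp ((A s - β : ℝ) * Complex.I) := by
      have : dslope q 0 (circlePoint ρ s) * (circlePoint ρ s * Complex.I)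
          = q (circlePoint ρ s) * Complex.I := by
        rw [← mul_dslope_zero hq0]; ring
      rw [this, hqs]
      push_cast
      rw [sub_mul, sub_eq_add_neg, Complex.exp_add, ← neg_mul]
      ring_nf
      rw [Complex.I_sq]
      ring
    rw [e1, hn, Complex.re_ofReal_mul, Complex.exp_ofReal_mul_I_re]
  have hcos : ∀ s ∈ Icc a b, 0 ≤ Real.cos (A s - β) := by
    intro s hs
    have h1 := hAm hs.1
    have h2 := hAm hs.2
    apply Real.cos_nonneg_of_neg_pi_div_two_le_of_le <;> linarith
  have hYm : MonotoneOn Y (Icc a b) := by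
    refine monotoneOn_of_deriv_nonneg (convex_Icc a b)
      (fun s _ => (hYd s).continuousAt.continuousWithinAt)
      (fun s _ => (hYd s).differentiableAt.differentiableWithinAt) fun s hs => ?_
    rw [(hYd s).deriv]
    exact mul_nonneg (norm_nonneg _) (hcos s (interior_subset hs))
  have hYab : Y a = Y b := by simp only [hY, heq]
  -- An interior point where the cosine is `1`. If `h` agreed at both ends, the monotone `Y` would
  -- be constant, forcing `q = 0` there.
  obtain ⟨c, hc, hAc⟩ : ∃ c ∈ Ioo a b, A c = β := by
    rcases (hAm hab.le).eq_or_lt with he | hl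
    · have hm : (a + b) / 2 ∈ Ioo a b := ⟨by linarith, by linarith⟩
      refine ⟨_, hm, ?_⟩
      have h1 := hAm hm.1.le
      have h2 := hAm hm.2.le
      linarith
    · obtain ⟨c, hc, h⟩ := intermediate_value_Ioo hab.le hAc.continuousOn
        (show β ∈ Ioo (A a) (A b) from ⟨by linarith, by linarith⟩)
      exact ⟨c, hc, h⟩
  have hloc : Y =ᶠ[𝓝 c] fun _ => Y a := by
    filter_upwards [Ioo_mem_nhds hc.1 hc.2] with s hs
    have hs' := Ioo_subset_Icc_self hs
    have h1 := hYm (left_mem_Icc.2 hab.le) hs' hs.1.le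
    have h2 := hYm hs' (right_mem_Icc.2 hab.le) hs.2.le
    linarith
  have h0 := (hYd c).unique ((hasDerivAt_const c (Y a)).congr_of_eventuallyEq hloc)
  rw [hAc, sub_self, Real.cos_zero, mul_one, norm_eq_zero, ← mul_dslope_zero hq0,
    ← hLq _ (circlePoint_mem_ball hρ0.le hρ1 c)] at h0
  rcases mul_eq_zero.1 h0 with h | h
  · have := norm_circlePoint hρ0.le c
    rw [h, norm_zero] at this
    exact hρ0.ne this
  · exact Complex.exp_ne_zero _ h

variable (hq : DifferentiableOn ℂ q (ball 0 1)) (hinj : InjOn q (ball 0 1)) (hq0 : q 0 = 0)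
  (hstar : ∀ z ∈ ball (0 : ℂ) 1, ∀ t : ℝ, 0 ≤ t → t ≤ 1 → (t : ℂ) * q z ∈ q '' ball 0 1)
  (hh : ∀ z ∈ ball (0 : ℂ) 1, HasDerivAt h (dslope q 0 z) z)

include hq hinj hq0 hstar hh

/-- The argument `A` of `q` is nondecreasing by starlikeness and grows by exactly `2π` over a full
turn. Of the two arcs joining two points of the circle, one therefore has increment at most `π`. -/
theorem injOn_sphere_of_starlike {ρ : ℝ} (hρ0 : 0 < ρ) (hρ1 : ρ < 1) :
    InjOn h (sphere 0 ρ) := by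
  obtain ⟨L, hL, hLq⟩ := exists_log_dslope hq hinj hq0
  set A : ℝ → ℝ := fun s => s + (L (circlePoint ρ s)).im with hA
  have hmem := circlePoint_mem_ball hρ0.le hρ1
  have hAd : ∀ s, HasDerivAt A (circlePoint ρ s * deriv q (circlePoint ρ s)
      / q (circlePoint ρ s)).re s := by
    intro s
    have h1 := (hasDerivAt_id s).add (hasDerivAt_im_of_hasDerivAt (hasDerivAt_comp_circlePoint
      (hL.differentiableAt (isOpen_ball.mem_nhds (hmem s))).hasDerivAt))
    refine h1.congr_deriv ?_
    have hne : circlePoint ρ s ≠ 0 := by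
      rw [← norm_pos_iff, norm_circlePoint hρ0.le]; exact hρ0
    rw [mul_deriv_div_eq_of_exp_eq_dslope hq0 hL hLq (hmem s) hne, ← mul_assoc,
      Complex.mul_I_im]
    simp [mul_comm]
  have hAc : Continuous A := continuous_iff_continuousAt.2 fun s => (hAd s).continuousAt
  have hAm : Monotone A := by
    refine monotone_of_deriv_nonneg (fun s => (hAd s).differentiableAt) fun s => ?_
    rw [(hAd s).deriv]
    refine re_mul_deriv_div_nonneg_of_starlike hq hinj hq0 hstar (by simpa using hmem s) ?_
    rw [← norm_pos_iff, norm_circlePoint hρ0.le]; exact hρ0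
  have key : ∀ a b : ℝ, a < b → b < a + 2 * Real.pi →
      h (circlePoint ρ a) ≠ h (circlePoint ρ b) := by
    intro a b hab hba
    have hper : A (a + 2 * Real.pi) = A a + 2 * Real.pi := by
      simp only [hA, circlePoint_add_two_pi]; ring
    by_cases hle : A b - A a ≤ Real.pi
    · exact ne_of_arg_increment_le_pi hq0 hh hLq hρ0 hρ1 hAc hAm (fun _ => rfl) hab hle
    · have := ne_of_arg_increment_le_pi hq0 hh hLq hρ0 hρ1 hAc hAm (fun _ => rfl) hba
        (by rw [hper]; linarith)
      rw [circlePoint_add_two_pi] at this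
      exact this.symm
  intro x hx y hy hxy
  have hrep : ∀ z ∈ sphere (0 : ℂ) ρ, z = circlePoint ρ z.arg := by
    intro z hz
    have hz' : ‖z‖ = ρ := by simpa using hz
    rw [circlePoint, ← hz', Complex.norm_mul_exp_arg_mul_I]
  rw [hrep x hx, hrep y hy] at hxy
  rw [hrep x hx, hrep y hy]
  have hx1 := Complex.neg_pi_lt_arg x
  have hx2 := Complex.arg_le_pi x
  have hy1 := Complex.neg_pi_lt_arg y
  have hy2 := Complex.arg_le_pi y
  rcases lt_trichotomy x.arg y.arg with hlt | he | hlt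
  · exact absurd hxy (key _ _ hlt (by linarith))
  · rw [he]
  · exact absurd hxy.symm (key _ _ hlt (by linarith))

/-- Radial induction on closed disks. Injectivity extends to a slightly larger disk by compactness
and local injectivity (`h' ≠ 0`), and to a limiting closed disk by the circle case and the open
mapping property. -/
theorem injOn_ball_of_starlike : InjOn h (ball 0 1) := by
  have hhd : DifferentiableOn ℂ h (ball 0 1) :=
    fun z hz => (hh z hz).differentiableAt.differentiableWithinAt
  have hne : ∀ z ∈ ball (0 : ℂ) 1, deriv h z ≠ 0 := by
    obtain ⟨L, hL, hLq⟩ := exists_log_dslope hq hinj hq0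
    intro z hz
    rw [(hh z hz).deriv, ← hLq z hz]
    exact Complex.exp_ne_zero _
  have hstrict : ∀ z ∈ ball (0 : ℂ) 1, HasStrictDerivAt h (deriv h z) z := fun z hz =>
    (hhd.analyticAt (isOpen_ball.mem_nhds hz)).hasStrictDerivAt
  have hloc : ∀ z ∈ ball (0 : ℂ) 1, ∃ u ∈ 𝓝 z, InjOn h u := by
    intro z hz
    have h1 := (hstrict z hz).hasStrictFDerivAt_equiv (hne z hz)
    exact ⟨_, (h1.toOpenPartialHomeomorph h).open_source.mem_nhds
      h1.mem_toOpenPartialHomeomorph_source, (h1.toOpenPartialHomeomorph h).injOn⟩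
  have hmain : ∀ ρ : ℝ, 0 ≤ ρ → ρ < 1 → InjOn h (closedBall 0 ρ) := by
    apply forall_mem_Ico_of_radial_induction
    · simp
    · exact fun σ ρ hσρ hi => hi.mono (closedBall_subset_closedBall hσρ)
    · intro ρ hρ0 hρ1 hi
      have hball : InjOn h (ball 0 ρ) := by
        intro x hx y hy hxy
        have hx' : ‖x‖ < ρ := by simpa using hx
        have hy' : ‖y‖ < ρ := by simpa using hy
        exact hi (max ‖x‖ ‖y‖) (by positivity) (max_lt hx' hy') (by simp) (by simp) hxy
      have hsub : closedBall (0 : ℂ) ρ ⊆ ball 0 1 := closedBall_subset_ball hρ1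
      -- If an interior point `x` and a boundary point `y` shared a value, interior points near `y`
      -- would take values already attained near `x`, contradicting injectivity on the open disk.
      have hcross : ∀ x ∈ ball (0 : ℂ) ρ, ∀ y ∈ sphere (0 : ℂ) ρ, h x ≠ h y := by
        intro x hx y hy hxy
        have hxy' : x ≠ y := by
          rintro rfl
          simp only [mem_ball, mem_sphere] at hx hy
          linarith
        obtain ⟨u, v, hu, hv, hxu, hyv, huv⟩ := t2_separation hxy'
        have hV : h '' (u ∩ ball 0 ρ) ∈ 𝓝 (h x) :=
          hball.image_mem_nhds isOpen_ball (hhd.mono (ball_subset_ball hρ1.le)) hx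
            (inter_mem (hu.mem_nhds hxu) (isOpen_ball.mem_nhds hx))
        rw [hxy] at hV
        have hy1 := (hh y (hsub (sphere_subset_closedBall hy))).continuousAt hV
        have hy2 : y ∈ closure (ball (0 : ℂ) ρ) := by
          rw [closure_ball _ hρ0.ne']; exact sphere_subset_closedBall hy
        obtain ⟨y', ⟨hy'1, hy'2⟩, hy'3⟩ :=
          mem_closure_iff_nhds.1 hy2 _ (inter_mem hy1 (hv.mem_nhds hyv))
        obtain ⟨x', ⟨hx'1, hx'2⟩, hx'3⟩ := hy'1
        have := hball hx'2 hy'3 hx'3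
        rw [this] at hx'1
        exact (disjoint_left.1 huv hx'1) hy'2
      intro x hx y hy hxy
      rw [← ball_union_sphere] at hx hy
      rcases hx with hx | hx <;> rcases hy with hy | hy
      · exact hball hx hy hxy
      · exact absurd hxy (hcross x hx y hy)
      · exact absurd hxy.symm (hcross y hy x hx)
      · exact injOn_sphere_of_starlike hq hinj hq0 hstar hh hρ0 hρ1 hx hy hxy
    · intro ρ hρ0 hρ1 hi
      have hsub : closedBall (0 : ℂ) ρ ⊆ ball 0 1 := closedBall_subset_ball hρ1
      obtain ⟨t, ht, hti⟩ := hi.exists_mem_nhdsSet (isCompact_closedBall 0 ρ)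
        (fun x hx => (hh x (hsub hx)).continuousAt) (fun x hx => hloc x (hsub hx))
      obtain ⟨δ, hδ, hδt⟩ := (isCompact_closedBall (0 : ℂ) ρ).exists_cthickening_subset_open
        isOpen_interior (subset_interior_iff_mem_nhdsSet.2 ht)
      rw [cthickening_closedBall hδ.le hρ0] at hδt
      exact ⟨δ + ρ, by linarith, hti.mono (hδt.trans interior_subset)⟩
  intro x hx y hy hxy
  have hx' : ‖x‖ < 1 := by simpa using hx
  have hy' : ‖y‖ < 1 := by simpa using hy
  exact hmain (max ‖x‖ ‖y‖) (by positivity) (max_lt hx' hy') (by simp) (by simp) hxy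

end AlexanderTransform

/-- At a point where `‖v‖` is maximal among all points of no larger modulus,
the logarithmic derivative `z v' / v` is a nonnegative real number. -/
theorem mul_div_nonneg_of_isMaxOn_closedBall {v : ℂ → ℂ} {v' z : ℂ} (hv : HasDerivAt v v' z)
    (hmax : ∀ y, ‖y‖ ≤ ‖z‖ → ‖v y‖ ≤ ‖v z‖) (hvz : v z ≠ 0) :
    0 ≤ (z * v' / v z).re ∧ (z * v' / v z).im = 0 := by
  -- The curve `z e^{tc}` does not leave the disk of radius `‖z‖` for `t ≥ 0`, so `‖v‖²` cannot
  -- increase initially. The choices `c = -1, ±i` give the sign of the real part and the vanishing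
  -- of the imaginary part.
  have key : ∀ c : ℂ, c.re ≤ 0 → (z * v' / v z * c).re ≤ 0 := by
    intro c hc
    have h1 : HasDerivAt (fun t : ℝ => z * Complex.exp (t * c)) (z * c) 0 := by
      have h : HasDerivAt (fun s : ℝ => (s : ℂ) * c) (1 * c) 0 :=
        (Complex.ofRealCLM.hasDerivAt (x := (0 : ℝ))).mul_const c
      refine (h.cexp.const_mul z).congr_deriv ?_
      simp
    have hv' : HasDerivAt v v' (z * Complex.exp ((0 : ℝ) * c)) := by simpa using hv
    have h2 := (hv'.comp (0 : ℝ) h1).norm_sq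
    have h3 := h2.nonpos_of_right_le one_pos (by
      intro t ht
      simp only [Function.comp]
      have : ‖z * Complex.exp (t * c)‖ ≤ ‖z‖ := by
        rw [norm_mul, Complex.norm_exp]
        have h4 : ((t : ℂ) * c).re ≤ 0 := by
          rw [Complex.re_ofReal_mul]
          exact mul_nonpos_of_nonneg_of_nonpos ht.1.le hc
        exact mul_le_of_le_one_right (norm_nonneg _) (Real.exp_le_one_iff.2 h4)
      have := hmax _ this
      simp only [Complex.ofReal_zero, zero_mul, Complex.exp_zero, mul_one]
      gcongr)
    simp only [Function.comp, Complex.ofReal_zero, zero_mul, Complex.exp_zero, mul_one,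
      Complex.inner] at h3
    have h5 : z * v' / v z * c = ((v' * (z * c)) * conj (v z)) * ((‖v z‖ ^ 2 : ℝ) : ℂ)⁻¹ := by
      have e1 : ((‖v z‖ ^ 2 : ℝ) : ℂ) = v z * conj (v z) := by
        rw [Complex.mul_conj, Complex.normSq_eq_norm_sq]
      have h8 : conj (v z) ≠ 0 := by simpa using hvz
      rw [e1]
      field_simp
    rw [h5, ← Complex.ofReal_inv, Complex.re_mul_ofReal]
    exact mul_nonpos_of_nonpos_of_nonneg (by linarith) (by positivity)
  have k1 := key (-1) (by simp)
  have k2 := key Complex.I (by simp)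
  have k3 := key (-Complex.I) (by simp)
  rw [mul_neg_one, Complex.neg_re] at k1
  rw [Complex.mul_I_re] at k2
  rw [mul_neg, Complex.neg_re, Complex.mul_I_re] at k3
  exact ⟨by linarith, by linarith⟩

/-! ### From `z g' ≺ z h'` to `g ≺ h` -/

section Subordination

variable {q h g p G : ℂ → ℂ}
  (hq : DifferentiableOn ℂ q (ball 0 1)) (hinj : InjOn q (ball 0 1)) (hq0 : q 0 = 0)
  (hstar : ∀ z ∈ ball (0 : ℂ) 1, ∀ t : ℝ, 0 ≤ t → t ≤ 1 → (t : ℂ) * q z ∈ q '' ball 0 1)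
  (hh : ∀ z ∈ ball (0 : ℂ) 1, HasDerivAt h (dslope q 0 z) z) (hh0 : h 0 = 0)
  (hg : DifferentiableOn ℂ g (ball 0 1)) (hg0 : g 0 = 0)
  (hgp : ∀ z ∈ ball (0 : ℂ) 1, z * deriv g z = p z)
  (hmaps : ∀ z ∈ ball (0 : ℂ) 1, p z ∈ q '' ball 0 1)

include hq hinj hq0 hstar hh hh0 hg hg0 hgp hmaps

/-- Jack's argument. Write `w = h⁻¹ ∘ g = z v` and let `|v|` be maximal at `z₀`. There `z₀ w'/w = 1
+ A` with `A ≥ 0` real, so `p z₀ = (1 + A) q(w z₀)`. Since `p z₀` lies in `q` of the closed disk of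
radius `|z₀|`, starlikeness puts `q(w z₀)` there too; univalence gives `|w z₀| ≤ |z₀|`, hence `|v
z₀| ≤ 1`. -/
theorem norm_leftInverse_comp_le (hG : ∀ z ∈ ball (0 : ℂ) 1, G (h z) = z)
    (hGd : DifferentiableOn ℂ G (h '' ball 0 1)) {ρ : ℝ} (hρ0 : 0 < ρ) (hρ1 : ρ < 1)
    (hsub : ∀ z ∈ closedBall (0 : ℂ) ρ, g z ∈ h '' ball 0 1) :
    ∀ z ∈ closedBall (0 : ℂ) ρ, ‖G (g z)‖ ≤ ‖z‖ := by
  have hhinj := injOn_ball_of_starlike hq hinj hq0 hstar hh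
  have hhd : DifferentiableOn ℂ h (ball 0 1) :=
    fun z hz => (hh z hz).differentiableAt.differentiableWithinAt
  have hhop := hhinj.isOpen_image isOpen_ball hhd
  set W : Set ℂ := ball 0 1 ∩ g ⁻¹' (h '' ball 0 1) with hW
  have hWo : IsOpen W := hg.continuousOn.isOpen_inter_preimage isOpen_ball hhop
  have hbW : closedBall (0 : ℂ) ρ ⊆ W := fun z hz => ⟨closedBall_subset_ball hρ1 hz, hsub z hz⟩
  set w : ℂ → ℂ := G ∘ g with hw
  have hwd : DifferentiableOn ℂ w W := hGd.comp (hg.mono inter_subset_left) fun z hz => hz.2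
  have hw0 : w 0 = 0 := by
    have := hG 0 (mem_ball_self one_pos)
    rw [hh0] at this
    simp [hw, hg0, this]
  have hwm : ∀ z ∈ W, w z ∈ ball (0 : ℂ) 1 ∧ h (w z) = g z := by
    rintro z ⟨-, y, hy, hyz⟩
    simp only [hw, Function.comp, ← hyz, hG y hy]
    exact ⟨hy, trivial⟩
  have h0W : (0 : ℂ) ∈ W := hbW (by simp [hρ0.le])
  set v := dslope w 0 with hvdef
  have hvd : DifferentiableOn ℂ v W := (Complex.differentiableOn_dslope (hWo.mem_nhds h0W)).2 hwd
  have hwv : ∀ z, w z = z * v z := fun z => (mul_dslope_zero hw0 z).symm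
  have hcl : closure (ball (0 : ℂ) ρ) = closedBall 0 ρ := closure_ball _ hρ0.ne'
  have hvdc : DiffContOnCl ℂ v (ball 0 ρ) :=
    (hvd.mono (by rw [hcl]; exact hbW)).diffContOnCl
  obtain ⟨z₀, hz₀f, hz₀m⟩ := Complex.exists_mem_frontier_isMaxOn_norm isBounded_ball
    ⟨0, mem_ball_self hρ0⟩ hvdc
  rw [frontier_ball _ hρ0.ne'] at hz₀f
  have hz₀n : ‖z₀‖ = ρ := by simpa using hz₀f
  have hmax : ∀ y, ‖y‖ ≤ ‖z₀‖ → ‖v y‖ ≤ ‖v z₀‖ := by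
    intro y hy
    exact hz₀m (by rw [hcl]; simpa [hz₀n] using hy)
  have hz₀0 : z₀ ≠ 0 := by rw [← norm_pos_iff, hz₀n]; exact hρ0
  suffices hM : ‖v z₀‖ ≤ 1 by
    intro z hz
    change ‖w z‖ ≤ _
    rw [hwv, norm_mul]
    exact mul_le_of_le_one_right (norm_nonneg _)
      ((hmax z (by simpa [hz₀n] using hz)).trans hM)
  by_contra! hM
  have hz₀W : z₀ ∈ W := hbW (sphere_subset_closedBall hz₀f)
  have hv0 : v z₀ ≠ 0 := by rw [← norm_pos_iff]; linarith
  have hvD := (hvd.differentiableAt (hWo.mem_nhds hz₀W)).hasDerivAt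
  obtain ⟨hre, him⟩ := mul_div_nonneg_of_isMaxOn_closedBall hvD hmax hv0
  set A := z₀ * deriv v z₀ / v z₀ with hA
  have hw₀0 : w z₀ ≠ 0 := by rw [hwv]; exact mul_ne_zero hz₀0 hv0
  obtain ⟨hw₀b, hw₀h⟩ := hwm z₀ hz₀W
  have hwD : HasDerivAt w (1 * v z₀ + z₀ * deriv v z₀) z₀ := by
    refine ((hasDerivAt_id z₀).mul hvD).congr_of_eventuallyEq ?_
    exact Eventually.of_forall fun y => hwv y
  have hgD : HasDerivAt g (dslope q 0 (w z₀) * (1 * v z₀ + z₀ * deriv v z₀)) z₀ := by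
    refine ((hh _ hw₀b).comp z₀ hwD).congr_of_eventuallyEq ?_
    filter_upwards [hWo.mem_nhds hz₀W] with y hy
    exact (hwm y hy).2.symm
  have hpz : p z₀ = (1 + A.re : ℝ) * q (w z₀) := by
    have hAre : ((1 + A.re : ℝ) : ℂ) = 1 + A := by
      rw [Complex.ofReal_add, Complex.ofReal_one, ← Complex.re_add_im A, him]
      simp
    rw [← hgp z₀ hz₀W.1, hgD.deriv, hAre, ← mul_dslope_zero hq0 (w z₀), hA, hwv z₀]
    field_simp
  have hpd : DifferentiableOn ℂ p (ball 0 1) :=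
    (differentiableOn_id.mul (hg.deriv isOpen_ball)).congr fun z hz => (hgp z hz).symm
  have hp0 : p 0 = 0 := by rw [← hgp 0 (mem_ball_self one_pos), zero_mul]
  obtain ⟨ω, hω, hωq⟩ := exists_schwarz_of_mapsTo_image hq hinj hq0 hpd hp0 hmaps
    (z := z₀) (by rw [hz₀n]; exact hρ1)
  have hpos : 0 < 1 + A.re := by linarith
  obtain ⟨ω', hω', hω'q⟩ := exists_norm_le_of_starlike hq hinj hq0 hstar (z := ω)
    (hω.trans_lt (by rw [hz₀n]; exact hρ1)) (t := (1 + A.re)⁻¹) (by positivity)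
    (inv_le_one_of_one_le₀ (by linarith))
  have hqe : q ω' = q (w z₀) := by
    rw [hω'q, hωq, hpz, ← mul_assoc, ← Complex.ofReal_mul, inv_mul_cancel₀ hpos.ne']
    simp
  have hle : ‖ω'‖ ≤ ‖z₀‖ := hω'.trans hω
  have := hinj (by simpa using hle.trans_lt (hz₀n.trans_lt hρ1)) hw₀b hqe
  rw [this, hwv, norm_mul] at hle
  have : 0 < ‖z₀‖ := by rw [hz₀n]; exact hρ0
  nlinarith

/-- `h⁻¹ ∘ g` makes sense only where `g` takes values in `h(𝔻)`, so that inclusion is proved by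
radial induction. The bound `‖h⁻¹(g z)‖ ≤ ‖z‖` confines the values to the compact set `h(closedBall
0 ρ)`, which lets the inclusion pass to the limit radius. -/
theorem exists_schwarz_subordination :
    ∃ w : ℂ → ℂ, DifferentiableOn ℂ w (ball 0 1) ∧ w 0 = 0 ∧
      ∀ z ∈ ball (0 : ℂ) 1, ‖w z‖ ≤ ‖z‖ ∧ h (w z) = g z := by
  have hhinj := injOn_ball_of_starlike hq hinj hq0 hstar hh
  have hhd : DifferentiableOn ℂ h (ball 0 1) :=
    fun z hz => (hh z hz).differentiableAt.differentiableWithinAt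
  have hhop := hhinj.isOpen_image isOpen_ball hhd
  obtain ⟨G, hG, hGd⟩ := hhinj.exists_differentiableOn_leftInverse isOpen_ball hhd
  have hWo : IsOpen (ball 0 1 ∩ g ⁻¹' (h '' ball 0 1)) :=
    hg.continuousOn.isOpen_inter_preimage isOpen_ball hhop
  have key : ∀ ρ : ℝ, 0 < ρ → ρ < 1 → (∀ z ∈ closedBall (0 : ℂ) ρ, g z ∈ h '' ball 0 1) →
      ∀ z ∈ closedBall (0 : ℂ) ρ, ‖G (g z)‖ ≤ ‖z‖ ∧ h (G (g z)) = g z := by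
    intro ρ hρ0 hρ1 hsub z hz
    refine ⟨norm_leftInverse_comp_le hq hinj hq0 hstar hh hh0 hg hg0 hgp hmaps hG hGd hρ0 hρ1
      hsub z hz, ?_⟩
    obtain ⟨y, hy, hyz⟩ := hsub z hz
    rw [← hyz, hG y hy]
  have hmain : ∀ ρ : ℝ, 0 ≤ ρ → ρ < 1 → ∀ z ∈ closedBall (0 : ℂ) ρ, g z ∈ h '' ball 0 1 := by
    apply forall_mem_Ico_of_radial_induction
    · intro z hz
      have : z = 0 := by simpa using hz
      rw [this, hg0]
      exact ⟨0, mem_ball_self one_pos, hh0⟩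
    · exact fun σ ρ hσρ hi z hz => hi z (closedBall_subset_closedBall hσρ hz)
    · intro ρ hρ0 hρ1 hi z hz
      have hsub : closedBall (0 : ℂ) ρ ⊆ ball 0 1 := closedBall_subset_ball hρ1
      have hball : MapsTo g (ball 0 ρ) (h '' closedBall 0 ρ) := by
        intro y hy
        have hy' : ‖y‖ < ρ := by simpa using hy
        obtain ⟨σ, hσ1, hσ2⟩ := exists_between hy'
        have hσ0 : 0 < σ := (norm_nonneg y).trans_lt hσ1
        have := key σ hσ0 (hσ2.trans hρ1) (hi σ hσ0.le hσ2) y (by simpa using hσ1.le)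
        exact ⟨_, by simpa using this.1.trans hy'.le, this.2⟩
      have hcpt : IsCompact (h '' closedBall 0 ρ) :=
        (isCompact_closedBall 0 ρ).image_of_continuousOn (hhd.continuousOn.mono hsub)
      have hcl : closure (ball (0 : ℂ) ρ) = closedBall 0 ρ := closure_ball _ hρ0.ne'
      have := hball.closure_of_continuousOn (hg.continuousOn.mono (by rw [hcl]; exact hsub))
        (by rwa [hcl] : z ∈ closure (ball (0 : ℂ) ρ))
      rw [hcpt.isClosed.closure_eq] at this
      exact image_mono hsub this
    · intro ρ hρ0 hρ1 hi
      obtain ⟨δ, hδ, hδt⟩ := (isCompact_closedBall (0 : ℂ) ρ).exists_cthickening_subset_open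
        hWo (fun z hz => ⟨closedBall_subset_ball hρ1 hz, hi z hz⟩)
      rw [cthickening_closedBall hδ.le hρ0] at hδt
      exact ⟨δ + ρ, by linarith, fun z hz => (hδt hz).2⟩
  have hall : ∀ z ∈ ball (0 : ℂ) 1, g z ∈ h '' ball 0 1 ∧ ‖G (g z)‖ ≤ ‖z‖ ∧ h (G (g z)) = g z := by
    intro z hz
    have hz' : ‖z‖ < 1 := by simpa using hz
    obtain ⟨σ, hσ1, hσ2⟩ := exists_between hz'
    have hσ0 : 0 < σ := (norm_nonneg z).trans_lt hσ1
    have hzσ : z ∈ closedBall (0 : ℂ) σ := by simpa using hσ1.le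
    exact ⟨hmain σ hσ0.le hσ2 z hzσ, key σ hσ0 hσ2 (hmain σ hσ0.le hσ2) z hzσ⟩
  refine ⟨G ∘ g, hGd.comp hg fun z hz => (hall z hz).1, ?_, fun z hz => (hall z hz).2⟩
  have := hG 0 (mem_ball_self one_pos)
  rw [hh0] at this
  simp [hg0, this]

end Subordination

open Real

/-! ### Littlewood's subordination principle -/

section Littlewood

variable {h w : ℂ → ℂ} {Ψ : ℝ → ℝ}

theorem ConvexOn.continuous_of_univ (hΨ : ConvexOn ℝ univ Ψ) : Continuous Ψ :=
  continuousOn_univ.1 (hΨ.continuousOn isOpen_univ)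

theorem continuousOn_convex_comp_re (hΨ : ConvexOn ℝ univ Ψ) {s : Set ℂ} (hh : ContinuousOn h s) :
    ContinuousOn (fun z => Ψ (h z).re) s :=
  hΨ.continuous_of_univ.comp_continuousOn (Complex.continuous_re.comp_continuousOn hh)

/-- Subharmonicity in Poisson form: an affine minorant of `Ψ` composed with `Re h` is harmonic,
hence reproduced by the nonnegative Poisson kernel. Minorants come arbitrarily close to `Ψ` at `Re
(h ζ)`. -/
theorem convex_re_le_circleAverage_herglotzRieszKernel (hΨ : ConvexOn ℝ univ Ψ) {R : ℝ}
    (hR0 : 0 < R) (hh : DifferentiableOn ℂ h (closedBall 0 R)) {ζ : ℂ} (hζ : ζ ∈ ball (0 : ℂ) R) :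
    Ψ (h ζ).re ≤ circleAverage
      ((Complex.re ∘ herglotzRieszKernel 0 ζ) • fun z => Ψ (h z).re) 0 R := by
  have hsub : sphere (0 : ℂ) |R| ⊆ closedBall 0 R := by
    rw [abs_of_pos hR0]; exact sphere_subset_closedBall
  have hK : ContinuousOn (Complex.re ∘ herglotzRieszKernel 0 ζ) (sphere 0 |R|) :=
    Complex.continuous_re.comp_continuousOn (continuousOn_herglotzRieszKernel_sphere hζ)
  refine le_of_forall_lt fun a ha => ?_
  obtain ⟨b, hab, hb⟩ := exists_between ha
  refine hab.trans_le ?_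
  obtain ⟨c, c', hle, heq⟩ := hΨ.exists_affine_le_of_lt_real (mem_univ _) hb isClosed_univ
    (hΨ.continuous_of_univ.lowerSemicontinuous.lowerSemicontinuousOn _)
  set F : ℂ → ℂ := fun z => c * h z + c' with hF
  have hFd : DifferentiableOn ℂ F (closedBall 0 R) := (hh.const_mul _).add_const _
  have hFre : ∀ z, (F z).re = c * (h z).re + c' := by
    intro z; simp [hF]
  have hFdc : DiffContOnCl ℂ F (ball 0 R) :=
    (hFd.mono closure_ball_subset_closedBall).diffContOnCl
  have h1 := hFdc.circleAverage_re_herglotzRieszKernel_smul hζ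
  have hint : CircleIntegrable ((Complex.re ∘ herglotzRieszKernel 0 ζ) • F) 0 R :=
    (hK.smul (hFd.continuousOn.mono hsub)).circleIntegrable'
  have h2 := Complex.reCLM.circleAverage_comp_comm hint
  rw [h1] at h2
  have h3 : b = circleAverage (Complex.reCLM ∘ ((Complex.re ∘ herglotzRieszKernel 0 ζ) • F)) 0 R := by
    rw [h2, Complex.reCLM_apply, hFre, heq]
  rw [h3]
  refine circleAverage_mono
    (Complex.continuous_re.comp_continuousOn
      (hK.smul (hFd.continuousOn.mono hsub))).circleIntegrable'
    (hK.smul (continuousOn_convex_comp_re hΨ (hh.continuousOn.mono hsub))).circleIntegrable'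
    fun z hz => ?_
  have hz' : z ∈ sphere (0 : ℂ) R := by rwa [abs_of_pos hR0] at hz
  have hK0 : 0 ≤ (herglotzRieszKernel 0 ζ z).re := by
    refine le_trans ?_ (le_re_herglotzRieszKernel hz' hζ)
    have : ‖ζ‖ < R := by simpa using hζ
    rw [sub_zero]
    exact div_nonneg (by linarith) (by positivity)
  have : ((Complex.re ∘ herglotzRieszKernel 0 ζ) • F) z
      = ((herglotzRieszKernel 0 ζ z).re : ℂ) * F z := by
    simp
  simp only [Function.comp, this, Complex.reCLM_apply, Complex.re_ofReal_mul, Pi.smul_apply',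
    smul_eq_mul, hFre]
  exact mul_le_mul_of_nonneg_left (hle _ (mem_univ _)) hK0

/-- `Re V` is the harmonic majorant of `Ψ(Re h)` with the same values on the circle of radius `R`.
Since `V ∘ w` is holomorphic and `w 0 = 0`, the mean of `Re V ∘ w` is `Re (V 0)`, the mean over that
circle. Taking `R > r` keeps the smaller circle inside the open disk where `V` is holomorphic. -/
theorem circleAverage_comp_schwarz_le_of_lt (hΨ : ConvexOn ℝ univ Ψ)
    (hh : DifferentiableOn ℂ h (ball 0 1)) (hw : DifferentiableOn ℂ w (ball 0 1)) (hw0 : w 0 = 0)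
    (hwle : ∀ z ∈ ball (0 : ℂ) 1, ‖w z‖ ≤ ‖z‖) {r R : ℝ} (hr : 0 < r) (hrR : r < R) (hR1 : R < 1) :
    circleAverage (fun z => Ψ (h (w z)).re) 0 r ≤ circleAverage (fun z => Ψ (h z).re) 0 R := by
  have hR0 := hr.trans hrR
  have hsub : closedBall (0 : ℂ) R ⊆ ball 0 1 := closedBall_subset_ball hR1
  have hsub' : sphere (0 : ℂ) |R| ⊆ ball 0 1 := by
    rw [abs_of_pos hR0]; exact sphere_subset_closedBall.trans hsub
  have hsubr : sphere (0 : ℂ) |r| ⊆ ball 0 R := by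
    rw [abs_of_pos hr]; exact sphere_subset_closedBall.trans (closedBall_subset_ball hrR)
  have hRball : ball (0 : ℂ) R ⊆ ball 0 1 := ball_subset_ball hR1.le
  have hmaps : MapsTo w (ball 0 R) (ball 0 R) := fun z hz => by
    have := hwle z (hRball hz)
    simp only [mem_ball_zero_iff] at hz ⊢
    exact this.trans_lt hz
  set g : ℂ → ℝ := fun z => Ψ (h z).re with hg
  have hgc : ContinuousOn g (ball 0 1) := continuousOn_convex_comp_re hΨ hh.continuousOn
  have hgi : CircleIntegrable g 0 R := (hgc.mono hsub').circleIntegrable'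
  have hgi' : CircleIntegrable (fun z => (g z : ℂ)) 0 R :=
    (Complex.continuous_ofReal.comp_continuousOn (hgc.mono hsub')).circleIntegrable'
  set V : ℂ → ℂ := fun ζ => circleAverage (fun z => herglotzRieszKernel 0 ζ z • (g z : ℂ)) 0 R
    with hV
  have hVd : DifferentiableOn ℂ V (ball 0 R) :=
    differentiableOn_circleAverage_herglotzRieszKernel_smul hgi'
  have hVre : ∀ ζ ∈ ball (0 : ℂ) R, g ζ ≤ (V ζ).re := by
    intro ζ hζ
    rw [hV, re_circleAverage_herglotzRieszKernel_smul hgi hζ]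
    exact convex_re_le_circleAverage_herglotzRieszKernel hΨ hR0 (hh.mono hsub) hζ
  have hV0 : (V 0).re = circleAverage g 0 R := by
    rw [hV, re_circleAverage_herglotzRieszKernel_smul hgi (mem_ball_self hR0)]
    refine circleAverage_congr_sphere fun z hz => ?_
    have hz0 : z ≠ 0 := by
      rintro rfl
      exact hR0.ne (by simpa [abs_of_pos hR0] using hz)
    simp [herglotzRieszKernel, div_self hz0]
  have hVwd : DifferentiableOn ℂ (V ∘ w) (ball 0 R) := hVd.comp (hw.mono hRball) hmaps
  have hVwdc : DiffContOnCl ℂ (V ∘ w) (ball 0 |r|) := by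
    refine (hVwd.mono ?_).diffContOnCl
    rw [abs_of_pos hr]
    exact closure_ball_subset_closedBall.trans (closedBall_subset_ball hrR)
  have hmean := hVwdc.circleAverage
  have hVwi : CircleIntegrable (V ∘ w) 0 r := (hVwd.continuousOn.mono hsubr).circleIntegrable'
  have h2 := Complex.reCLM.circleAverage_comp_comm hVwi
  rw [hmean, Function.comp_apply, hw0, Complex.reCLM_apply, hV0] at h2
  rw [← h2]
  refine circleAverage_mono ?_ ?_ fun z hz => ?_
  · exact ((hgc.comp (hw.continuousOn.mono hRball)
      (hmaps.mono_right hRball)).mono hsubr).circleIntegrable'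
  · exact (Complex.continuous_re.comp_continuousOn
      (hVwd.continuousOn.mono hsubr)).circleIntegrable'
  · exact hVre _ (hmaps (hsubr hz))

/-- **Littlewood's subordination principle** for convex functions of the real part. -/
theorem circleAverage_comp_schwarz_le (hΨ : ConvexOn ℝ univ Ψ)
    (hh : DifferentiableOn ℂ h (ball 0 1)) (hw : DifferentiableOn ℂ w (ball 0 1)) (hw0 : w 0 = 0)
    (hwle : ∀ z ∈ ball (0 : ℂ) 1, ‖w z‖ ≤ ‖z‖) {r : ℝ} (hr : 0 < r) (hr1 : r < 1) :
    circleAverage (fun z => Ψ (h (w z)).re) 0 r ≤ circleAverage (fun z => Ψ (h z).re) 0 r := by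
  -- Circle means depend continuously on the radius, so `R` may decrease to `r`.
  have hcont : ContinuousOn (circleAverage (fun z => Ψ (h z).re) 0) (Ico 0 1) := by
    refine ContinuousOn.circleAverage ?_ fun _ hx => hx.1
    refine (continuousOn_convex_comp_re hΨ hh.continuousOn).mono fun z hz => ?_
    simpa using hz.2
  have ht := ((hcont.continuousAt (Ico_mem_nhds hr hr1)).tendsto).mono_left
    (nhdsWithin_le_nhds (s := Ioi r))
  refine ge_of_tendsto ht ?_
  filter_upwards [Ioo_mem_nhdsGT hr1] with R hR
  exact circleAverage_comp_schwarz_le_of_lt hΨ hh hw hw0 hwle hr hR.1 hR.2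

theorem circleMap_zero_eq_circlePoint (r s : ℝ) : circleMap 0 r s = circlePoint r s := by
  simp [circleMap, circlePoint]

theorem circleAverage_eq_integral_circlePoint (F : ℂ → ℝ) (r : ℝ) :
    circleAverage F 0 r = (2 * π)⁻¹ * ∫ s in (-π)..π, F (circlePoint r s) := by
  rw [circleAverage_eq_integral_add (-π), smul_eq_mul,
    intervalIntegral.integral_comp_add_right (fun s => F (circleMap 0 r s))]
  simp only [circleMap_zero_eq_circlePoint]
  ring_nf

theorem integral_comp_schwarz_le (hΨ : ConvexOn ℝ univ Ψ)
    (hh : DifferentiableOn ℂ h (ball 0 1)) (hw : DifferentiableOn ℂ w (ball 0 1)) (hw0 : w 0 = 0)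
    (hwle : ∀ z ∈ ball (0 : ℂ) 1, ‖w z‖ ≤ ‖z‖) {r : ℝ} (hr : 0 < r) (hr1 : r < 1) :
    ∫ s in (-π)..π, Ψ (h (w (circlePoint r s))).re
      ≤ ∫ s in (-π)..π, Ψ (h (circlePoint r s)).re := by
  have := circleAverage_comp_schwarz_le hΨ hh hw hw0 hwle hr hr1
  rw [circleAverage_eq_integral_circlePoint, circleAverage_eq_integral_circlePoint] at this
  exact le_of_mul_le_mul_left this (by positivity)

end Littlewood

open MeasureTheory

/-! ### The extremal map satisfies `k' = exp h` -/

section SegmentIntegral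

theorem ofReal_mul_mem_ball {z : ℂ} (hz : z ∈ ball (0 : ℂ) 1) {t : ℝ} (ht : t ∈ Icc (0 : ℝ) 1) :
    (t : ℂ) * z ∈ ball (0 : ℂ) 1 := by
  simp only [mem_ball_zero_iff, norm_mul, Complex.norm_real, Real.norm_of_nonneg ht.1] at hz ⊢
  exact (mul_le_of_le_one_left (norm_nonneg z) ht.2).trans_lt hz

theorem segmentIntegral_eq_sub {G H : ℂ → ℂ} (hG : ContinuousOn G (ball 0 1))
    (hH : ∀ z ∈ ball (0 : ℂ) 1, HasDerivAt H (G z) z) {z : ℂ} (hz : z ∈ ball (0 : ℂ) 1) :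
    segmentIntegral G z = H z - H 0 := by
  have hd : ∀ t : ℝ, HasDerivAt (fun t : ℝ => (t : ℂ) * z) z t := fun t => by
    simpa using (Complex.ofRealCLM.hasDerivAt (x := t)).mul_const z
  have := intervalIntegral.integral_eq_sub_of_hasDerivAt (a := 0) (b := 1)
    (f := fun t : ℝ => H ((t : ℂ) * z)) (f' := fun t : ℝ => G ((t : ℂ) * z) * z) (fun t ht => by
      rw [uIcc_of_le zero_le_one] at ht
      exact (hH _ (ofReal_mul_mem_ball hz ht)).comp t (hd t)) (by
      refine ContinuousOn.intervalIntegrable ?_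
      rw [uIcc_of_le zero_le_one]
      exact (hG.comp (by fun_prop) fun t ht => ofReal_mul_mem_ball hz ht).mul continuousOn_const)
  simpa [segmentIntegral] using this

theorem segmentIntegral_congr {G₁ G₂ : ℂ → ℂ}
    (hG : ∀ z ∈ ball (0 : ℂ) 1, z ≠ 0 → G₁ z = G₂ z) {z : ℂ} (hz : z ∈ ball (0 : ℂ) 1) :
    segmentIntegral G₁ z = segmentIntegral G₂ z := by
  refine intervalIntegral.integral_congr_ae (ae_of_all _ fun t ht => ?_)
  rw [uIoc_of_le zero_le_one] at ht
  rcases eq_or_ne z 0 with rfl | hz0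
  · simp
  · rw [hG _ (ofReal_mul_mem_ball hz ⟨ht.1.le, ht.2⟩)
      (mul_ne_zero (by exact_mod_cast ht.1.ne') hz0)]

theorem deriv_extremalMap {φ h : ℂ → ℂ} (hφ1 : φ 0 = 1) (hφ : DifferentiableOn ℂ φ (ball 0 1))
    (hh : ∀ z ∈ ball (0 : ℂ) 1, HasDerivAt h (dslope (fun ζ => φ ζ - 1) 0 z) z) (hh0 : h 0 = 0)
    {z : ℂ} (hz : z ∈ ball (0 : ℂ) 1) : deriv (extremalMap φ) z = Complex.exp (h z) := by
  have hQ : DifferentiableOn ℂ (dslope (fun ζ => φ ζ - 1) 0) (ball 0 1) :=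
    (Complex.differentiableOn_dslope (ball_mem_nhds 0 one_pos)).2 (hφ.sub_const 1)
  have hseg : ∀ y ∈ ball (0 : ℂ) 1, segmentIntegral (fun ζ => (φ ζ - 1) / ζ) y = h y := by
    intro y hy
    rw [segmentIntegral_congr (G₂ := dslope (fun ζ => φ ζ - 1) 0) (fun x _ hx0 => ?_) hy,
      segmentIntegral_eq_sub hQ.continuousOn hh hy, hh0, sub_zero]
    rw [dslope_of_ne _ hx0, slope_def_field, hφ1]
    simp
  have hed : DifferentiableOn ℂ (fun y => Complex.exp (h y)) (ball 0 1) :=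
    fun y hy => (hh y hy).cexp.differentiableAt.differentiableWithinAt
  obtain ⟨K, hK⟩ := hed.isExactOn_ball
  have hk : ∀ y ∈ ball (0 : ℂ) 1, extremalMap φ y = K y - K 0 := by
    intro y hy
    rw [extremalMap, segmentIntegral_congr (G₂ := fun y => Complex.exp (h y)) (fun x hx _ => ?_) hy,
      segmentIntegral_eq_sub hed.continuousOn hK hy]
    rw [hseg x hx]
  refine HasDerivAt.deriv (((hK z hz).sub_const (K 0)).congr_of_eventuallyEq ?_)
  filter_upwards [isOpen_ball.mem_nhds hz] with y hy using hk y hy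

end SegmentIntegral

/-! ### Conjugation symmetry of `φ` -/

section Symmetric

variable {Ω : Set ℂ} {φ : ℂ → ℂ}

/-- With `ψ = conj ∘ φ ∘ conj`, the map `φ⁻¹ ∘ ψ` is a self-map of the disk fixing `0` with
derivative `1`, hence the identity by the equality case of the Schwarz lemma. -/
theorem IsNormalizedConformalMap.map_conj (hφ : IsNormalizedConformalMap Ω φ)
    (hΩ : ∀ w ∈ Ω, conj w ∈ Ω) {z : ℂ} (hz : z ∈ ball (0 : ℂ) 1) : φ (conj z) = conj (φ z) := by
  have hcb : ∀ z ∈ ball (0 : ℂ) 1, conj z ∈ ball (0 : ℂ) 1 := fun z hz => by simpa using hz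
  have h0 : (0 : ℂ) ∈ ball (0 : ℂ) 1 := mem_ball_self one_pos
  have hφ0 : HasDerivAt φ (deriv φ 0) 0 :=
    (hφ.differentiableOn.differentiableAt (isOpen_ball.mem_nhds h0)).hasDerivAt
  have hreal : conj (deriv φ 0) = deriv φ 0 := Complex.conj_eq_iff_im.2 hφ.deriv_zero_im
  have hd0 : deriv φ 0 ≠ 0 := hφ.injOn.deriv_ne_zero isOpen_ball hφ.differentiableOn h0
  set ψ : ℂ → ℂ := conj ∘ φ ∘ conj with hψ
  have hψd : DifferentiableOn ℂ ψ (ball 0 1) := fun y hy => by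
    have := (hφ.differentiableOn.differentiableAt (isOpen_ball.mem_nhds (hcb y hy))).conj_conj
    rw [Complex.conj_conj] at this
    exact this.differentiableWithinAt
  have hψ0 : HasDerivAt ψ (deriv φ 0) 0 := by
    have := hφ0.conj_conj
    rwa [_root_.map_zero, hreal] at this
  have hψm : MapsTo ψ (ball 0 1) (φ '' ball 0 1) := by
    intro y hy
    rw [hφ.image_eq]
    refine hΩ _ ?_
    rw [← hφ.image_eq]
    exact mem_image_of_mem _ (hcb y hy)
  obtain ⟨G, hG, hGd⟩ := hφ.injOn.exists_differentiableOn_leftInverse isOpen_ball hφ.differentiableOn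
  have hGm : ∀ y ∈ ball (0 : ℂ) 1, G (ψ y) ∈ ball (0 : ℂ) 1 ∧ φ (G (ψ y)) = ψ y := by
    intro y hy
    obtain ⟨x, hx, hxy⟩ := hψm hy
    rw [← hxy, hG x hx]
    exact ⟨hx, rfl⟩
  have hWd : DifferentiableOn ℂ (G ∘ ψ) (ball 0 1) := hGd.comp hψd hψm
  have hψ00 : ψ 0 = φ 0 := by simp [hψ, hφ.map_zero]
  have hW0 : (G ∘ ψ) 0 = 0 := by
    rw [Function.comp_apply, hψ00, hG 0 h0]
  have hW'0 : deriv (G ∘ ψ) 0 = 1 := by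
    have hGD : HasDerivAt G (deriv φ 0)⁻¹ (ψ 0) := by
      rw [hψ00]
      exact hφ.injOn.differentiableAt_leftInverse_of_deriv_ne_zero isOpen_ball hφ.differentiableOn
        hG h0 hd0
    rw [(hGD.comp 0 hψ0).deriv, inv_mul_cancel₀ hd0]
  have heq := Complex.affine_of_mapsTo_ball_of_norm_dslope_eq_div (R₂ := 1) hWd
    (fun y hy => by rw [hW0]; exact ball_subset_closedBall (hGm y hy).1) h0
    (by rw [dslope_same, hW'0]; simp)
  have h1 := heq (hcb z hz)
  rw [dslope_same, hW'0, hW0] at h1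
  simp only [Function.comp_apply, smul_eq_mul, mul_one, sub_zero, zero_add] at h1
  have h2 := (hGm _ (hcb z hz)).2
  rw [h1] at h2
  simpa [hψ] using h2

/-- A real value of `φ` at `y` gives `φ (conj y) = φ y`, so `y` is real. Thus `Im φ` has constant
sign on the connected upper half-disk, and `φ'(0) > 0` decides the sign along the imaginary axis. -/
theorem IsNormalizedConformalMap.im_pos (hφ : IsNormalizedConformalMap Ω φ)
    (hΩ : ∀ w ∈ Ω, conj w ∈ Ω) {z : ℂ} (hz : z ∈ ball (0 : ℂ) 1) (hzim : 0 < z.im) :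
    0 < (φ z).im := by
  have hne : ∀ y ∈ ball (0 : ℂ) 1, 0 < y.im → (φ y).im ≠ 0 := by
    intro y hy hyim h0
    have h1 := hφ.map_conj hΩ hy
    rw [Complex.conj_eq_iff_im.2 h0] at h1
    have h2 := hφ.injOn (by simpa using hy) hy h1
    rw [Complex.conj_eq_iff_im] at h2
    exact hyim.ne' h2
  by_contra! hle
  have hconv : Convex ℝ (ball (0 : ℂ) 1 ∩ {y | 0 < y.im}) :=
    (convex_ball 0 1).inter (convex_halfSpace_im_gt 0)
  have hneg : ∀ y ∈ ball (0 : ℂ) 1, 0 < y.im → (φ y).im < 0 := by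
    intro y hy hyim
    by_contra! h
    obtain ⟨x, hx, hx0⟩ := hconv.isPreconnected.intermediate_value
      (f := fun y => (φ y).im) (a := z) (b := y) ⟨hz, hzim⟩ ⟨hy, hyim⟩
      (Complex.continuous_im.comp_continuousOn
        (hφ.differentiableOn.continuousOn.mono inter_subset_left)) ⟨hle, h⟩
    exact hne x hx.1 hx.2 hx0
  have h0 : (0 : ℂ) ∈ ball (0 : ℂ) 1 := mem_ball_self one_pos
  have hφ0 : HasDerivAt φ (deriv φ 0) (((0 : ℝ) : ℂ) * Complex.I) := by
    simpa using (hφ.differentiableOn.differentiableAt (isOpen_ball.mem_nhds h0)).hasDerivAt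
  have hl : HasDerivAt (fun t : ℝ => (t : ℂ) * Complex.I) Complex.I 0 := by
    simpa using (Complex.ofRealCLM.hasDerivAt (x := (0 : ℝ))).mul_const Complex.I
  have hd := hasDerivAt_im_of_hasDerivAt (hφ0.comp (0 : ℝ) hl)
  have := hd.nonpos_of_right_le one_pos (by
    intro t ht
    have hmem : (t : ℂ) * Complex.I ∈ ball (0 : ℂ) 1 := by
      simpa [abs_of_pos ht.1] using ht.2
    have := hneg _ hmem (by simpa using ht.1)
    simpa [hφ.map_zero] using this.le)
  rw [Complex.mul_I_im] at this
  exact absurd hφ.deriv_zero_re_pos (not_lt.2 this)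

end Symmetric

/-- Truncating `Φ` at its value at `U θ` turns the full-circle majorization into one over sets of
measure `2θ`: `∫_E Φ(u) ≤ ∫_E Ψ(u) + 2θb ≤ ∫_{-π}^{π} Ψ(U) + 2θb = ∫_{-θ}^{θ} Φ(U)`. -/
theorem setIntegral_convex_le_of_symmetric_decreasing {u U : ℝ → ℝ} (hu : Continuous u)
    (hU : Continuous U) (heven : ∀ s, U (-s) = U s) (hanti : AntitoneOn U (Icc 0 π))
    (hmaj : ∀ Ψ : ℝ → ℝ, ConvexOn ℝ univ Ψ →
      ∫ s in (-π)..π, Ψ (u s) ≤ ∫ s in (-π)..π, Ψ (U s))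
    {E : Set ℝ} {θ : ℝ} (hE : E ⊆ Icc (-π) π) (hθ : 0 ≤ θ)
    (hvol : volume E = ENNReal.ofReal (2 * θ)) {Φ : ℝ → ℝ} (hΦ : ConvexOn ℝ univ Φ)
    (hΦm : Monotone Φ) :
    IntegrableOn (fun s => Φ (u s)) E ∧ IntegrableOn (fun s => Φ (U s)) (Icc (-θ) θ) ∧
      ∫ s in E, Φ (u s) ≤ ∫ s in Icc (-θ) θ, Φ (U s) := by
  have hΦc := hΦ.continuous_of_univ
  have hθπ : θ ≤ π := by
    have h1 := measure_mono (μ := volume) hE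
    rw [hvol, Real.volume_Icc, ENNReal.ofReal_le_ofReal_iff (by linarith [pi_pos])] at h1
    linarith
  have hIcc : Icc (-θ) θ ⊆ Icc (-π) π := Icc_subset_Icc (by linarith) hθπ
  have hintE : ∀ F : ℝ → ℝ, Continuous F → IntegrableOn F E := fun F hF =>
    (hF.continuousOn.integrableOn_compact isCompact_Icc).mono_set hE
  have hintI : ∀ F : ℝ → ℝ, Continuous F → ∀ a b, IntegrableOn F (Icc a b) := fun F hF a b =>
    hF.continuousOn.integrableOn_compact isCompact_Icc
  have hEreal : volume.real E = 2 * θ := by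
    rw [measureReal_def, hvol, ENNReal.toReal_ofReal (by linarith)]
  refine ⟨hintE _ (hΦc.comp hu), hintI _ (hΦc.comp hU) _ _, ?_⟩
  have habs : ∀ s, U |s| = U s := fun s => by
    rcases abs_choice s with h | h <;> rw [h]
    exact heven s
  set b := Φ (U θ) with hb
  set Ψ : ℝ → ℝ := fun x => max (Φ x - b) 0 with hΨdef
  have hΨ : ConvexOn ℝ univ Ψ := by
    have h1 : ConvexOn ℝ univ (fun x => Φ x - b) := by
      simp only [sub_eq_add_neg]
      exact hΦ.add_const (-b)
    exact h1.sup (convexOn_const 0 convex_univ)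
  have hΨc := hΨ.continuous_of_univ
  have hΨ0 : ∀ x, 0 ≤ Ψ x := fun x => le_max_right _ _
  have hin : ∀ s ∈ Icc (-θ) θ, Ψ (U s) = Φ (U s) - b := by
    intro s hs
    have hs' : |s| ≤ θ := abs_le.2 hs
    refine max_eq_left (sub_nonneg.2 (hΦm ?_))
    rw [← habs s]
    exact hanti ⟨abs_nonneg s, hs'.trans hθπ⟩ ⟨hθ, hθπ⟩ hs'
  have hout : ∀ s ∈ Icc (-π) π \ Icc (-θ) θ, Ψ (U s) = 0 := by
    intro s hs
    have h1 : |s| ≤ π := abs_le.2 hs.1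
    have h2 : θ ≤ |s| := by
      by_contra! h
      exact hs.2 (abs_le.1 h.le)
    refine max_eq_right (sub_nonpos.2 (hΦm ?_))
    rw [← habs s]
    exact hanti ⟨hθ, hθπ⟩ ⟨abs_nonneg s, h1⟩ h2
  have hmajI : ∫ s in Icc (-π) π, Ψ (u s) ≤ ∫ s in Icc (-π) π, Ψ (U s) := by
    have := hmaj Ψ hΨ
    rwa [intervalIntegral.integral_of_le (by linarith [pi_pos]),
      intervalIntegral.integral_of_le (by linarith [pi_pos]),
      ← integral_Icc_eq_integral_Ioc, ← integral_Icc_eq_integral_Ioc] at this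
  have hstep1 : ∫ s in E, Φ (u s) ≤ ∫ s in E, (Ψ (u s) + b) := by
    refine setIntegral_mono (f := fun s => Φ (u s)) (hintE _ (hΦc.comp hu))
      (hintE _ ((hΨc.comp hu).add continuous_const)) fun s => ?_
    have : Φ (u s) - b ≤ Ψ (u s) := le_max_left _ _
    simp only
    linarith
  have hstep2 : ∫ s in E, (Ψ (u s) + b) = (∫ s in E, Ψ (u s)) + 2 * θ * b := by
    rw [integral_add (f := fun s => Ψ (u s)) (hintE _ (hΨc.comp hu)) (hintE _ continuous_const), setIntegral_const, hEreal,
      smul_eq_mul]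
  have hstep3 : ∫ s in E, Ψ (u s) ≤ ∫ s in Icc (-π) π, Ψ (u s) :=
    setIntegral_mono_set (hintI _ (hΨc.comp hu) _ _) (ae_of_all _ fun s => hΨ0 _)
      hE.eventuallyLE
  have hstep4 : ∫ s in Icc (-π) π, Ψ (U s) = ∫ s in Icc (-θ) θ, Ψ (U s) :=
    setIntegral_eq_of_subset_of_forall_sdiff_eq_zero measurableSet_Icc hIcc hout
  have hstep5 : ∫ s in Icc (-θ) θ, Ψ (U s) = (∫ s in Icc (-θ) θ, Φ (U s)) - 2 * θ * b := by
    rw [setIntegral_congr_fun measurableSet_Icc hin,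
      integral_sub (f := fun s => Φ (U s)) (hintI _ (hΦc.comp hU) _ _) (hintI _ continuous_const _ _), setIntegral_const,
      measureReal_def, Real.volume_Icc, ENNReal.toReal_ofReal (by linarith), smul_eq_mul]
    ring
  linarith

/-! ### The logarithm of `f'` and the main theorem -/

theorem MemConvexClass.exists_log_deriv {Ω : Set ℂ} {f : ℂ → ℂ} (hf : MemConvexClass Ω f) :
    ∃ g : ℂ → ℂ, DifferentiableOn ℂ g (ball 0 1) ∧ g 0 = 0 ∧
      (∀ z ∈ ball (0 : ℂ) 1, deriv f z = Complex.exp (g z)) ∧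
      ∀ z ∈ ball (0 : ℂ) 1, 1 + z * deriv g z ∈ Ω := by
  have hf' : DifferentiableOn ℂ (deriv f) (ball 0 1) := hf.differentiableOn.deriv isOpen_ball
  have h0 : (0 : ℂ) ∈ ball (0 : ℂ) 1 := mem_ball_self one_pos
  obtain ⟨g, hg0, hg⟩ := ((hf'.deriv isOpen_ball).div hf'
    fun z hz => (hf.mem z hz).1).isExactOn_ball.with_val_at 0 0
  refine ⟨g, fun z hz => (hg z hz).differentiableAt.differentiableWithinAt, hg0, ?_, ?_⟩
  · intro z hz
    have hconst : ∀ y ∈ ball (0 : ℂ) 1,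
        HasDerivAt (fun y => deriv f y * Complex.exp (-g y)) 0 y := by
      intro y hy
      refine ((hf'.differentiableAt (isOpen_ball.mem_nhds hy)).hasDerivAt.mul
        (hg y hy).neg.cexp).congr_deriv ?_
      have := (hf.mem y hy).1
      simp only [Pi.div_apply]
      field_simp
      ring
    have h2 := isOpen_ball.is_const_of_deriv_eq_zero (convex_ball (0 : ℂ) 1).isPreconnected
      (fun y hy => (hconst y hy).differentiableAt.differentiableWithinAt)
      (fun y hy => (hconst y hy).deriv) hz h0
    simp only [hg0, hf.deriv_zero, Complex.exp_neg, Complex.exp_zero, inv_one, mul_one] at h2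
    have := Complex.exp_ne_zero (g z)
    field_simp at h2
    exact h2
  · intro z hz
    rw [(hg z hz).deriv, Pi.div_apply, ← mul_div_assoc]
    exact (hf.mem z hz).2

theorem log_norm_exp (z : ℂ) : Real.log ‖Complex.exp z‖ = z.re := by
  rw [Complex.norm_exp, Real.log_exp]

theorem theorem4 (Ω : Set ℂ) (hΩ_open : IsOpen Ω) (hΩ_one : (1 : ℂ) ∈ Ω)
    (hΩ_ne : Ω ≠ Set.univ) (hΩ_star : StarConvex ℝ (1 : ℂ) Ω)
    (hΩ_symm : ∀ w ∈ Ω, conj w ∈ Ω)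
    (φ : ℂ → ℂ) (hφ : IsNormalizedConformalMap Ω φ)
    (r : ℝ) (hr0 : 0 < r) (hr1 : r < 1) :
    (∀ θ : ℝ, Real.log ‖deriv (extremalMap φ) (circlePoint r (-θ))‖
        = Real.log ‖deriv (extremalMap φ) (circlePoint r θ)‖) ∧
    StrictAntiOn (fun θ : ℝ => Real.log ‖deriv (extremalMap φ) (circlePoint r θ)‖)
      (Set.Icc 0 Real.pi) ∧
    ∀ f : ℂ → ℂ, MemConvexClass Ω f →
      ∀ (E : Set ℝ) (θ : ℝ), E ⊆ Set.Icc (-Real.pi) Real.pi →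
        MeasureTheory.NullMeasurableSet E MeasureTheory.volume → 0 ≤ θ →
        MeasureTheory.volume E = ENNReal.ofReal (2 * θ) →
        (∀ Φ : ℝ → ℝ, ConvexOn ℝ Set.univ Φ → Monotone Φ →
          MeasureTheory.IntegrableOn
            (fun s : ℝ => Φ (Real.log ‖deriv f (circlePoint r s)‖)) E ∧
          MeasureTheory.IntegrableOn
            (fun s : ℝ => Φ (Real.log ‖deriv (extremalMap φ) (circlePoint r s)‖))
            (Set.Icc (-θ) θ) ∧
          ∫ s in E, Φ (Real.log ‖deriv f (circlePoint r s)‖)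
            ≤ ∫ s in Set.Icc (-θ) θ,
                Φ (Real.log ‖deriv (extremalMap φ) (circlePoint r s)‖)) ∧
        imageLength f r E ≤ imageLength (extremalMap φ) r (Set.Icc (-θ) θ) := by
  set q : ℂ → ℂ := fun ζ => φ ζ - 1 with hqdef
  have hq : DifferentiableOn ℂ q (ball 0 1) := hφ.differentiableOn.sub_const 1
  have hinj : InjOn q (ball 0 1) := fun x hx y hy hxy => hφ.injOn hx hy (sub_left_injective hxy)
  have hq0 : q 0 = 0 := by simp [hqdef, hφ.map_zero]
  have himage : ∀ y, 1 + y ∈ Ω → y ∈ q '' ball 0 1 := by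
    intro y hy
    rw [← hφ.image_eq] at hy
    obtain ⟨x, hx, hxy⟩ := hy
    exact ⟨x, hx, by simp [hqdef, hxy]⟩
  have hstar : ∀ z ∈ ball (0 : ℂ) 1, ∀ t : ℝ, 0 ≤ t → t ≤ 1 →
      (t : ℂ) * q z ∈ q '' ball 0 1 := by
    intro z hz t ht0 ht1
    refine himage _ ?_
    have hz' : φ z ∈ Ω := hφ.image_eq ▸ mem_image_of_mem φ hz
    have := hΩ_star.add_smul_sub_mem hz' ht0 ht1
    simpa [hqdef] using this
  have hQ : DifferentiableOn ℂ (dslope q 0) (ball 0 1) :=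
    (Complex.differentiableOn_dslope (ball_mem_nhds 0 one_pos)).2 hq
  obtain ⟨h, hh0, hh⟩ := hQ.isExactOn_ball.with_val_at 0 0
  have hhd : DifferentiableOn ℂ h (ball 0 1) :=
    fun z hz => (hh z hz).differentiableAt.differentiableWithinAt
  have hmem := circlePoint_mem_ball hr0.le hr1
  set U : ℝ → ℝ := fun s => (h (circlePoint r s)).re with hUdef
  have hkderiv : ∀ s, deriv (extremalMap φ) (circlePoint r s) = Complex.exp (h (circlePoint r s)) :=
    fun s => deriv_extremalMap hφ.map_zero hφ.differentiableOn hh hh0 (hmem s)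
  have hklog : ∀ s, Real.log ‖deriv (extremalMap φ) (circlePoint r s)‖ = U s := fun s => by
    rw [hkderiv, log_norm_exp]
  -- Along the circle `d/ds h = i z h' = i (φ - 1)`, whose real part is `-Im φ`.
  have hUd : ∀ s, HasDerivAt U (-(φ (circlePoint r s)).im) s := by
    intro s
    refine (hasDerivAt_re_of_hasDerivAt (hasDerivAt_comp_circlePoint (hh _ (hmem s)))).congr_deriv ?_
    have : dslope q 0 (circlePoint r s) * (circlePoint r s * Complex.I)
        = q (circlePoint r s) * Complex.I := by
      rw [← mul_dslope_zero hq0]; ring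
    rw [this, Complex.mul_I_re]
    simp [hqdef]
  have hUc : Continuous U := continuous_iff_continuousAt.2 fun s => (hUd s).continuousAt
  have hconj : ∀ s, circlePoint r (-s) = conj (circlePoint r s) := by
    intro s
    simp [circlePoint, ← Complex.exp_conj]
  have heven : ∀ s, U (-s) = U s := by
    have hd : ∀ s, HasDerivAt (fun s => U (-s) - U s) 0 s := by
      intro s
      have h1 := ((hUd (-s)).comp s (hasDerivAt_neg s)).sub (hUd s)
      refine h1.congr_deriv ?_
      rw [hconj, hφ.map_conj hΩ_symm (hmem s)]
      simp
    intro s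
    have := is_const_of_deriv_eq_zero (fun s => (hd s).differentiableAt) (fun s => (hd s).deriv) s 0
    simp only [neg_zero, sub_self] at this
    linarith
  have hanti : StrictAntiOn U (Icc 0 π) := by
    refine strictAntiOn_of_deriv_neg (convex_Icc 0 π) hUc.continuousOn fun s hs => ?_
    rw [interior_Icc] at hs
    rw [(hUd s).deriv, neg_lt_zero]
    refine hφ.im_pos hΩ_symm (hmem s) ?_
    rw [circlePoint, Complex.im_ofReal_mul, Complex.exp_ofReal_mul_I_im]
    exact mul_pos hr0 (sin_pos_of_pos_of_lt_pi hs.1 hs.2)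
  simp only [hklog]
  refine ⟨heven, hanti, fun f hf E θ hE hEm hθ hvol => ?_⟩
  obtain ⟨g, hgd, hg0, hfg, hgΩ⟩ := hf.exists_log_deriv
  obtain ⟨w, hwd, hw0, hw⟩ := exists_schwarz_subordination hq hinj hq0 hstar hh hh0 hgd hg0
    (p := fun z => z * deriv g z) (fun z _ => rfl) (fun z hz => himage _ (hgΩ z hz))
  set u : ℝ → ℝ := fun s => (g (circlePoint r s)).re with hudef
  have hflog : ∀ s, Real.log ‖deriv f (circlePoint r s)‖ = u s := fun s => by
    rw [hfg _ (hmem s), log_norm_exp]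
  have huc : Continuous u := Complex.continuous_re.comp
    (hgd.continuousOn.comp_continuous (continuous_circlePoint r) hmem)
  have hmaj : ∀ Ψ : ℝ → ℝ, ConvexOn ℝ univ Ψ →
      ∫ s in (-π)..π, Ψ (u s) ≤ ∫ s in (-π)..π, Ψ (U s) := by
    intro Ψ hΨ
    have := integral_comp_schwarz_le hΨ hhd hwd hw0 (fun z hz => (hw z hz).1) hr0 hr1
    simpa only [fun s => (hw _ (hmem s)).2] using this
  simp only [hflog]
  have key := fun (Φ : ℝ → ℝ) hΦ hΦm => setIntegral_convex_le_of_symmetric_decreasing huc hUc heven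
    hanti.antitoneOn hmaj hE hθ hvol (Φ := Φ) hΦ hΦm
  refine ⟨key, ?_⟩
  -- `r * exp` applied to `log |f'|` recovers the length density `r |f'|`.
  have hlen := (key (fun x => r * Real.exp x) (by
    simpa using convexOn_exp.smul hr0.le) fun x y hxy => by dsimp only; gcongr).2.2
  simpa only [imageLength, hkderiv, fun s => hfg _ (hmem s), Complex.norm_exp] using hlen
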